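/- Let $N\ge 2$, $G>0$, and let $m_1,\dots,m_N\ge 0$ be masses that are not all zero (for example, all positive). Let $\Delta=\{q\in\mathbb{R}^{3N} : q_i=q_j \text{ for some } i\ne j\}$ and consider the $N$-body equations $$\frac{dq_i}{dt}=v_i,\qquad \frac{dv_i}{dt}=g_i(q):=\sum_{j\ne i}\frac{G\,m_j}{\|q_i-q_j\|^3}(q_j-q_i),\qquad i=1,\dots,N,$$ for $q\in\mathbb{R}^{3N}\setminus\Delta$, $v\in\mathbb{R}^{3N}$. Put $$s(q,v)=\Bigl(\sum_{i<j}\frac{\|v_i-v_j\|^2}{\|q_i-q_j\|^2}+A(q)\sum_{i<j}\frac{G(m_i+m_j)}{\|q_i-q_j\|^2}\Bigr)^{-1/2},\qquad A(q)=\sum_{i<j}\frac1{\|q_i-q_j\|},$$ and $\beta=0.0444443$. Then $s$ determines a uniform global time-renormalization of the $N$-body equations with parameter $\beta$. That is, $s$ is positive and real-analytic on $(\mathbb{R}^{3N}\setminus\Delta)\times\mathbb{R}^{3N}$, and for all $q^0\in\mathbb{R}^{3N}\setminus\Delta$ and $v^0\in\mathbb{R}^{3N}$ the following hold. (1) Let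 $(q(t),v(t))$, $t\in(t_a,t_b)$, be the maximal solution of the $N$-body equations with $q(0)=q^0$, $v(0)=v^0$. Then $\theta(t)=\int_0^t s(q(t'),v(t'))^{-1}\,dt'$ is a bijection of $(t_a,t_b)$ onto $\mathbb{R}$, and the functions $\hat q,\hat v$ with $\hat q(\theta(t))=q(t)$, $\hat v(\theta(t))=v(t)$ extend to $\mathbb{C}^{3N}$-valued functions holomorphic in a neighbourhood of the closed strip $\{\tau\in\mathbb{C} : |\mathrm{Im}\,\tau|\le\beta\}$. (2) There are $\mathbb{C}^{3N}$-valued functions $\hat q,\hat v$, holomorphic in a neighbourhood of this strip and uniquely determined on the strip, whose restrictions to $\mathbb{R}$ are real with $\hat q(\tau)\notin\Delta$ and satisfy, for all $\tau\in\mathbb{R}$, $$\frac{d\hat q_i}{d\tau}=s(\hat q,\hat v)\,\hat v_i,\qquad \frac{d\hat v_i}{d\tau}=s(\hat q,\hat v)\,g_i(\hat q),\qquad \hat q(0)=q^0,\quad \hat v(0)=v^0.$$ -/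

import Mathlib

noncomputable section

namespace NBody

/-- Euclidean three-space. -/
abbrev E3 : Type := EuclideanSpace ℝ (Fin 3)

/-- Complexified three-space, with its Hermitian norm. -/
abbrev C3 : Type := EuclideanSpace ℂ (Fin 3)

/-- `N` vectors of `ℝ³`: the space `ℝ^(3N)` of positions, or of velocities. -/
abbrev Config (N : ℕ) : Type := Fin N → E3

/-- `N` vectors of `ℂ³`: the space `ℂ^(3N)`. -/
abbrev CConfig (N : ℕ) : Type := Fin N → C3

/-- The inclusion `ℝ^(3N) ⊆ ℂ^(3N)`. -/
def complexify {N : ℕ} (x : Config N) : CConfig N :=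
  fun i => WithLp.toLp 2 (fun k => ((x i k : ℝ) : ℂ))

/-- The collision set `Δ`. -/
def collisionSet (N : ℕ) : Set (Config N) :=
  {q | ∃ i j, i ≠ j ∧ q i = q j}

/-- The gravitational accelerations: the right-hand side of the equations for the velocities. -/
def accel {N : ℕ} (G : ℝ) (m : Fin N → ℝ) (q : Config N) : Config N :=
  fun i => ∑ j ∈ Finset.univ.erase i, (G * m j / ‖q i - q j‖ ^ 3) • (q j - q i)

/-- `(q, v)` solves the `N`-body equations on the (open) set `I` of times,
without collisions. -/
def IsSolutionOn {N : ℕ} (G : ℝ) (m : Fin N → ℝ) (I : Set ℝ) (q v : ℝ → Config N) : Prop :=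
  ∀ t ∈ I, q t ∉ collisionSet N ∧ HasDerivAt q (v t) t ∧ HasDerivAt v (accel G m (q t)) t

/-- `(q, v)`, on the open interval `I` around `0`, is a maximal solution of the `N`-body
equations with initial values `(q0, v0)`: it has no continuation as a solution to a larger
open interval. -/
structure IsMaximalSolution {N : ℕ} (G : ℝ) (m : Fin N → ℝ) (q0 v0 : Config N)
    (I : Set ℝ) (q v : ℝ → Config N) : Prop where
  isOpen : IsOpen I
  ordConnected : I.OrdConnected
  zero_mem : (0 : ℝ) ∈ I
  solution : IsSolutionOn G m I q v
  init_q : q 0 = q0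
  init_v : v 0 = v0
  maximal : ∀ (J : Set ℝ) (q' v' : ℝ → Config N), IsOpen J → J.OrdConnected → I ⊆ J →
    IsSolutionOn G m J q' v' → Set.EqOn q' q I → Set.EqOn v' v I → J = I

/-- The fictitious time `θ(t) = ∫₀ᵗ s(q(t'), v(t'))⁻¹ dt'`. -/
def fictitiousTime {N : ℕ} (s : Config N → Config N → ℝ) (q v : ℝ → Config N) (t : ℝ) : ℝ :=
  ∫ t' in (0 : ℝ)..t, (s (q t') (v t'))⁻¹

/-- The closed strip `{τ ∈ ℂ : |Im τ| ≤ β}`. -/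
def strip (β : ℝ) : Set ℂ := {τ | |τ.im| ≤ β}

/-- The positive real-analytic function `s` on `(ℝ^(3N) \ Δ) × ℝ^(3N)` determines a uniform
global time-renormalization of the `N`-body equations with parameter `β > 0`: for all initial
values outside the collision set, the fictitious time maps the interval of existence of the
maximal solution bijectively onto `ℝ`, and the solution, as a function of the fictitious time,
extends analytically to the closed strip of half-width `β` (that is, to a function that is
holomorphic in a neighbourhood of it). -/
def IsUniformGlobalTimeRenormalization {N : ℕ} (G : ℝ) (m : Fin N → ℝ)
    (s : Config N → Config N → ℝ) (β : ℝ) : Prop :=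
  0 < β ∧
  AnalyticOnNhd ℝ (fun p : Config N × Config N => s p.1 p.2)
    ((collisionSet N)ᶜ ×ˢ Set.univ) ∧
  (∀ q ∉ collisionSet N, ∀ v : Config N, 0 < s q v) ∧
  ∀ q0 ∉ collisionSet N, ∀ v0 : Config N, ∀ (I : Set ℝ) (q v : ℝ → Config N),
    IsMaximalSolution G m q0 v0 I q v →
      Set.BijOn (fictitiousTime s q v) I Set.univ ∧
      ∃ Q V : ℂ → CConfig N,
        AnalyticOnNhd ℂ Q (strip β) ∧ AnalyticOnNhd ℂ V (strip β) ∧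
        ∀ t ∈ I, Q (fictitiousTime s q v t : ℂ) = complexify (q t) ∧
          V (fictitiousTime s q v t : ℂ) = complexify (v t)

/-- `(Q, V)` is holomorphic (in a neighbourhood of each point) on the strip of half-width `β`
and its restriction to the real axis is a real, collision-free solution, for all `τ ∈ ℝ`, of
the renormalized equations `dq/dτ = s(q, v) v`, `dv/dτ = s(q, v) g(q)`, with initial values
`(q0, v0)`. -/
def IsHolomorphicRenormalizedSolution {N : ℕ} (G : ℝ) (m : Fin N → ℝ)
    (s : Config N → Config N → ℝ) (β : ℝ) (q0 v0 : Config N) (Q V : ℂ → CConfig N) : Prop :=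
  AnalyticOnNhd ℂ Q (strip β) ∧ AnalyticOnNhd ℂ V (strip β) ∧
  ∃ q v : ℝ → Config N,
    q 0 = q0 ∧ v 0 = v0 ∧
    (∀ τ : ℝ, q τ ∉ collisionSet N ∧
      HasDerivAt q (s (q τ) (v τ) • v τ) τ ∧
      HasDerivAt v (s (q τ) (v τ) • accel G m (q τ)) τ) ∧
    ∀ τ : ℝ, Q (τ : ℂ) = complexify (q τ) ∧ V (τ : ℂ) = complexify (v τ)

/-- `A(q) = ∑_{i<j} 1 / ‖q_i - q_j‖`. -/
def invDistSum {N : ℕ} (q : Config N) : ℝ :=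
  ∑ i, ∑ j ∈ Finset.Ioi i, 1 / ‖q i - q j‖

/-- The alternative time-renormalization function
`s(q,v) = (∑_{i<j} (‖v_i-v_j‖/‖q_i-q_j‖)² + A(q) ∑_{i<j} G(m_i+m_j)/‖q_i-q_j‖²)^(-1/2)`. -/
def sAlt {N : ℕ} (G : ℝ) (m : Fin N → ℝ) (q v : Config N) : ℝ :=
  ((∑ i, ∑ j ∈ Finset.Ioi i, (‖v i - v j‖ / ‖q i - q j‖) ^ 2) +
    invDistSum q *
      (∑ i, ∑ j ∈ Finset.Ioi i, G * (m i + m j) / ‖q i - q j‖ ^ 2)) ^ (-(1 / 2) : ℝ)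

end NBody

end

/-! Write `D = s⁻²`, `A` for the sum of inverse distances and `K` for the gravitational sum, so that
`D` is the sum of the squares `(‖v_i-v_j‖/‖q_i-q_j‖)²` plus `A K`. Three inequalities drive
everything: `‖v_i-v_j‖ ≤ √D ‖q_i-q_j‖`, `A K ≤ D` and `1/A ≤ ‖q_i-q_j‖`. They say that in fictitious
time the relative positions move at relative rate at most 1, and that accelerations are at most
`√D/A` once multiplied by `s`. Hence a solution needs a fixed amount of fictitious time, the same at
all phase points, to change its relative data by a fixed proportion.

This persists in complex time. Around a regular real point take the compact convex `box` where
relative positions are perturbed by at most 8.5% and velocities by at most `0.11 √D/A`. There the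
complexified field is holomorphic and is bounded by constants times its natural scales,
independently of `N` and of the point (`norm_cInvSqS_sub_le`, `norm_cAccel_le`). By `box_step`,
increments `τ F` with `|τ| < 0.046` do not leave the box, so Picard iteration
(`exists_holomorphic_solution`) gives a solution holomorphic on a disc of radius 0.046.

A uniform existence time makes real solutions global (`exists_isTrajectory_univ`), and the discs
around all real points glue, by the identity theorem, to the strip of half-width 0.046 > 0.0444443
(`exists_analyticOnNhd_strip`). Finally `bijOn_fictitiousTime_of_global` undoes the change of time:
`T(τ) = ∫ s` inverts `θ`, and maximality of the original solution makes its interval the whole range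
of `T`. -/

noncomputable section

namespace NBody

open Set Filter Topology Metric
open scoped ContDiff

/-! ### Picard iteration in complex time. -/

section HolomorphicODE

variable {E : Type*} [NormedAddCommGroup E] [NormedSpace ℂ E]

/-- The increment over the unit interval lies in every closed convex set that contains the
derivatives. -/
theorem sub_mem_of_hasDerivAt_mem [CompleteSpace E] {C : Set E} (hC : Convex ℝ C) (hCc : IsClosed C)
    {h h' : ℝ → E} (hd : ∀ u ∈ Icc (0 : ℝ) 1, HasDerivAt h (h' u) u)
    (hc : ContinuousOn h' (Icc 0 1)) (hm : ∀ u ∈ Icc (0 : ℝ) 1, h' u ∈ C) :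
    h 1 - h 0 ∈ C := by
  have hint : IntervalIntegrable h' MeasureTheory.volume 0 1 := by
    apply ContinuousOn.intervalIntegrable
    rwa [uIcc_of_le zero_le_one]
  have h1 : ∫ u in (0 : ℝ)..1, h' u = h 1 - h 0 := by
    apply intervalIntegral.integral_eq_sub_of_hasDerivAt _ hint
    rwa [uIcc_of_le zero_le_one]
  rw [← h1, intervalIntegral.integral_of_le zero_le_one]
  -- The integral over the unit interval is an average, and averages of points of a closed convex
  -- set stay in it.
  have : MeasureTheory.IsProbabilityMeasure
      ((MeasureTheory.volume : MeasureTheory.Measure ℝ).restrict (Ioc 0 1)) :=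
    ⟨by simp⟩
  refine hC.integral_mem hCc ?_ ?_
  · rw [MeasureTheory.ae_restrict_iff' measurableSet_Ioc]
    exact Eventually.of_forall fun u hu => hm u (Ioc_subset_Icc_self hu)
  · exact (intervalIntegrable_iff_integrableOn_Ioc_of_le zero_le_one).1 hint

/-- `f` is a candidate in the Picard iteration on the disc of radius `ρ`: it is holomorphic, takes
the initial value at `0`, stays in `B`, and is in `W` on the real axis. -/
structure IsPicardCandidate (B W : Set E) (x0 : E) (ρ : ℝ) (f : ℂ → E) : Prop where
  zero : f 0 = x0
  diff : DifferentiableOn ℂ f (ball 0 ρ)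
  mem : ∀ z ∈ ball (0 : ℂ) ρ, f z ∈ B
  real_mem : ∀ t : ℝ, (t : ℂ) ∈ ball (0 : ℂ) ρ → f t ∈ W

theorem smul_mem_ball_zero {ρ : ℝ} {z : ℂ} (hz : z ∈ ball (0 : ℂ) ρ) {u : ℝ}
    (hu : u ∈ Icc (0 : ℝ) 1) : (u : ℂ) * z ∈ ball (0 : ℂ) ρ := by
  rw [mem_ball_zero_iff] at hz ⊢
  rw [norm_mul, Complex.norm_real, Real.norm_of_nonneg hu.1]
  nlinarith [norm_nonneg z, hu.2]

theorem hasDerivAt_ray {g : ℂ → E} {g' : E} {z : ℂ} {u : ℝ}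
    (h : HasDerivAt g g' ((u : ℂ) * z)) :
    HasDerivAt (fun u : ℝ => g ((u : ℂ) * z)) (z • g') u := by
  have h1 : HasDerivAt (fun u : ℝ => (u : ℂ) * z) z u := by
    simpa using (Complex.ofRealCLM.hasDerivAt (x := u)).mul_const z
  exact HasDerivAt.scomp u h h1

/-- The next iterate is the primitive `g` of `F ∘ f` with `g 0 = x0`. Its value `g z` is the average
over `u ∈ [0, 1]` of `x0 + z F(f(uz))`, so a closed convex set containing all these points contains
`g z`. This is used for `B` and, at real `z`, for `W`. -/
theorem IsPicardCandidate.step [CompleteSpace E] {B W : Set E} {F : E → E} {x0 : E} {ρ : ℝ}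
    (hBc : Convex ℝ B) (hBcl : IsClosed B) (hF : ∀ x ∈ B, DifferentiableAt ℂ F x)
    (hstep : ∀ x ∈ B, ∀ τ : ℂ, ‖τ‖ < ρ → x0 + τ • F x ∈ B)
    (hWc : Convex ℝ W) (hWcl : IsClosed W)
    (hW : ∀ x ∈ B, x ∈ W → ∀ t : ℝ, x0 + (t : ℂ) • F x ∈ W)
    {f : ℂ → E} (hf : IsPicardCandidate B W x0 ρ f) :
    ∃ g : ℂ → E, IsPicardCandidate B W x0 ρ g ∧
      ∀ z ∈ ball (0 : ℂ) ρ, HasDerivAt g (F (f z)) z := by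
  have hd : DifferentiableOn ℂ (fun z => F (f z)) (ball 0 ρ) := fun z hz =>
    ((hF _ (hf.mem z hz)).comp_differentiableWithinAt z (hf.diff z hz))
  obtain ⟨g, hg0, hg⟩ := hd.isExactOn_ball.with_val_at 0 x0
  have key : ∀ C : Set E, Convex ℝ C → IsClosed C → ∀ z ∈ ball (0 : ℂ) ρ,
      (∀ u ∈ Icc (0 : ℝ) 1, x0 + z • F (f (u * z)) ∈ C) → g z ∈ C := by
    intro C hC hCcl z hz hm
    -- Adding `u • x0` turns the increment over `[0, 1]` into `g z` itself, as `g 0 = x0`.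
    have h1 : ∀ u ∈ Icc (0 : ℝ) 1, HasDerivAt (fun u : ℝ => u • x0 + g ((u : ℂ) * z))
        (x0 + z • F (f (u * z))) u := by
      intro u hu
      have := ((hasDerivAt_id u).smul_const x0).fun_add
        (hasDerivAt_ray (hg _ (smul_mem_ball_zero hz hu)))
      simpa using this
    have h2 : ContinuousOn (fun u : ℝ => x0 + z • F (f (u * z))) (Icc 0 1) := by
      refine continuousOn_const.add (continuousOn_const.smul ?_)
      exact hd.continuousOn.comp (by fun_prop) fun u hu => smul_mem_ball_zero hz hu
    have := sub_mem_of_hasDerivAt_mem hC hCcl h1 h2 hm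
    simpa [hg0] using this
  refine ⟨g, ⟨hg0, fun z hz => (hg z hz).differentiableAt.differentiableWithinAt,
    fun z hz => ?_, fun t ht => ?_⟩, hg⟩
  · refine key B hBc hBcl z hz fun u hu => hstep _ (hf.mem _ (smul_mem_ball_zero hz hu)) z ?_
    simpa using hz
  · refine key W hWc hWcl t ht fun u hu => ?_
    have h3 := smul_mem_ball_zero ht hu
    refine hW _ (hf.mem _ h3) ?_ t
    have := hf.real_mem (u * t) (by push_cast; exact h3)
    push_cast at this
    exact this

/-- Picard's theorem on a disc in complex time, for a field that maps a compact convex set into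
increments that do not leave it. -/
theorem exists_holomorphic_solution [CompleteSpace E] {B W : Set E} {F : E → E} {x0 : E} {ρ : ℝ}
    (hBc : Convex ℝ B) (hBk : IsCompact B) (hF : ∀ x ∈ B, DifferentiableAt ℂ F x)
    {K : NNReal} (hL : LipschitzOnWith K F B) (hx0B : x0 ∈ B)
    (hstep : ∀ x ∈ B, ∀ τ : ℂ, ‖τ‖ < ρ → x0 + τ • F x ∈ B)
    (hWc : Convex ℝ W) (hWcl : IsClosed W) (hx0W : x0 ∈ W)
    (hW : ∀ x ∈ B, x ∈ W → ∀ t : ℝ, x0 + (t : ℂ) • F x ∈ W) :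
    ∃ f : ℂ → E, f 0 = x0 ∧
      (∀ z ∈ ball (0 : ℂ) ρ, f z ∈ B ∧ HasDerivAt f (F (f z)) z) ∧
      ∀ t : ℝ, (t : ℂ) ∈ ball (0 : ℂ) ρ → f t ∈ W := by
  have hBcl := hBk.isClosed
  choose! Φ hΦ hΦd using fun (f : ℂ → E) (hf : IsPicardCandidate B W x0 ρ f) =>
    hf.step hBc hBcl hF hstep hWc hWcl hW
  let φ : ℕ → ℂ → E := fun n => Φ^[n] (fun _ => x0)
  have hφs : ∀ n, φ (n + 1) = Φ (φ n) := fun n => Function.iterate_succ_apply' _ _ _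
  have hφ : ∀ n, IsPicardCandidate B W x0 ρ (φ n) := by
    intro n
    induction n with
    | zero => exact ⟨rfl, differentiableOn_const _, fun _ _ => hx0B, fun _ _ => hx0W⟩
    | succ n ih => rw [hφs]; exact hΦ _ ih
  have hφd : ∀ n, ∀ z ∈ ball (0 : ℂ) ρ, HasDerivAt (φ (n + 1)) (F (φ n z)) z := by
    intro n; rw [hφs]; exact hΦd _ (hφ n)
  set M := diam B with hM
  have hM0 : 0 ≤ M := diam_nonneg
  -- The weight `exp (2K‖z‖)` makes the Picard map contract by 1/2 however large `K ρ` is: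
  -- integrating `K exp (2K r)` gives back at most half the weight. The induction compares
  -- derivatives along the ray from 0 to `z`.
  have hbd : ∀ n, ∀ z ∈ ball (0 : ℂ) ρ,
      ‖φ (n + 1) z - φ n z‖ ≤ M * Real.exp (2 * K * ‖z‖) / 2 ^ n := by
    intro n
    induction n with
    | zero =>
      intro z hz
      have h1 := dist_le_diam_of_mem hBk.isBounded ((hφ 1).mem z hz) ((hφ 0).mem z hz)
      rw [dist_eq_norm] at h1
      have h2 : 1 ≤ Real.exp (2 * K * ‖z‖) := Real.one_le_exp (by positivity)
      simp only [zero_add, pow_zero, div_one]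
      nlinarith
    | succ n ih =>
      intro z hz
      have hder : ∀ u ∈ Icc (0 : ℝ) 1, HasDerivAt
          (fun u : ℝ => φ (n + 1 + 1) ((u : ℂ) * z) - φ (n + 1) ((u : ℂ) * z))
          (z • F (φ (n + 1) (u * z)) - z • F (φ n (u * z))) u := fun u hu =>
        (hasDerivAt_ray (hφd (n + 1) _ (smul_mem_ball_zero hz hu))).sub
          (hasDerivAt_ray (hφd n _ (smul_mem_ball_zero hz hu)))
      have hBd : ∀ u : ℝ, HasDerivAt
          (fun u : ℝ => M / 2 ^ (n + 1) * Real.exp (2 * K * ‖z‖ * u))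
          (M / 2 ^ (n + 1) * (Real.exp (2 * K * ‖z‖ * u) * (2 * K * ‖z‖))) u := by
        intro u
        have := (((hasDerivAt_id u).const_mul (2 * K * ‖z‖)).exp).const_mul (M / 2 ^ (n + 1))
        simpa using this
      have := image_norm_le_of_norm_deriv_right_le_deriv_boundary
        (fun u hu => (hder u hu).continuousAt.continuousWithinAt)
        (fun u hu => (hder u (Ico_subset_Icc_self hu)).hasDerivWithinAt)
        (B := fun u : ℝ => M / 2 ^ (n + 1) * Real.exp (2 * K * ‖z‖ * u))
        (B' := fun u : ℝ => M / 2 ^ (n + 1) * (Real.exp (2 * K * ‖z‖ * u) * (2 * K * ‖z‖)))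
        ?_ hBd ?_ (right_mem_Icc.2 zero_le_one)
      · simp only [Complex.ofReal_one, one_mul, mul_one] at this
        rw [mul_div_right_comm]
        exact this
      · simp only [Complex.ofReal_zero, zero_mul, (hφ _).zero, sub_self, norm_zero]
        positivity
      · intro u hu
        have hu' := Ico_subset_Icc_self hu
        have hz' := smul_mem_ball_zero hz hu'
        rw [← smul_sub, norm_smul]
        have h1 := hL.norm_sub_le ((hφ (n + 1)).mem _ hz') ((hφ n).mem _ hz')
        have h2 := ih _ hz'
        rw [norm_mul, Complex.norm_real, Real.norm_of_nonneg hu'.1] at h2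
        have h3 : 2 * (K : ℝ) * (u * ‖z‖) = 2 * K * ‖z‖ * u := by ring
        rw [h3] at h2
        calc ‖z‖ * ‖F (φ (n + 1) (u * z)) - F (φ n (u * z))‖
            ≤ ‖z‖ * (K * (M * Real.exp (2 * K * ‖z‖ * u) / 2 ^ n)) := by gcongr; exact h1.trans (by gcongr)
          _ = _ := by rw [pow_succ]; field_simp
  set C := 2 * (M * Real.exp (2 * K * ρ)) with hC
  have hbd' : ∀ z ∈ ball (0 : ℂ) ρ, ∀ n, dist (φ n z) (φ (n + 1) z) ≤ C / 2 / 2 ^ n := by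
    intro z hz n
    rw [dist_comm, dist_eq_norm]
    refine (hbd n z hz).trans ?_
    have : ‖z‖ ≤ ρ := by rw [mem_ball_zero_iff] at hz; exact hz.le
    rw [hC, mul_div_cancel_left₀ _ two_ne_zero]
    gcongr
  have hlim : ∀ z, ∃ y, z ∈ ball (0 : ℂ) ρ → Tendsto (fun n => φ n z) atTop (𝓝 y) := by
    intro z
    by_cases hz : z ∈ ball (0 : ℂ) ρ
    · obtain ⟨y, hy⟩ := cauchySeq_tendsto_of_complete
        (cauchySeq_of_le_geometric_two (hbd' z hz))
      exact ⟨y, fun _ => hy⟩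
    · exact ⟨x0, fun h => absurd h hz⟩
  choose f hf using hlim
  have hunif : TendstoUniformlyOn φ f atTop (ball 0 ρ) := by
    rw [Metric.tendstoUniformlyOn_iff]
    intro ε hε
    have h1 : Tendsto (fun n : ℕ => C / 2 ^ n) atTop (𝓝 0) := by
      have := (tendsto_pow_atTop_nhds_zero_of_lt_one (r := (1 / 2 : ℝ))
        (by norm_num) (by norm_num)).const_mul C
      simpa [div_eq_mul_inv] using this
    filter_upwards [h1.eventually (gt_mem_nhds hε)] with n hn z hz
    rw [dist_comm]
    exact (dist_le_of_le_geometric_two_of_tendsto (hbd' z hz) (hf z hz) n).trans_lt hn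
  have hloc := hunif.tendstoLocallyUniformlyOn
  have hfd : DifferentiableOn ℂ f (ball 0 ρ) :=
    hloc.differentiableOn (Eventually.of_forall fun n => (hφ n).diff) isOpen_ball
  have hfB : ∀ z ∈ ball (0 : ℂ) ρ, f z ∈ B := fun z hz =>
    hBcl.mem_of_tendsto (hf z hz) (Eventually.of_forall fun n => (hφ n).mem z hz)
  have hf0 : 0 < ρ → f 0 = x0 := fun h => tendsto_nhds_unique (hf 0 (by simpa using h))
    (by simp only [(hφ _).zero]; exact tendsto_const_nhds)
  -- For `ρ ≤ 0` the disc is empty and only the value at 0 matters.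
  by_cases hρ : 0 < ρ
  swap
  · refine ⟨fun _ => x0, rfl, fun z hz => ?_, fun _ _ => hx0W⟩
    rw [ball_eq_empty.2 (not_lt.1 hρ)] at hz
    exact absurd hz (notMem_empty _)
  refine ⟨f, hf0 hρ, fun z hz => ⟨hfB z hz, ?_⟩, fun t ht =>
    hWcl.mem_of_tendsto (hf t ht) (Eventually.of_forall fun n => (hφ n).real_mem t ht)⟩
  have h1 : HasDerivAt f (deriv f z) z :=
    ((hfd z hz).differentiableAt (isOpen_ball.mem_nhds hz)).hasDerivAt
  -- Locally uniform limits of holomorphic functions may be differentiated termwise, which gives the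
  -- equation in the limit.
  have h2 : Tendsto (fun n => deriv (φ (n + 1)) z) atTop (𝓝 (deriv f z)) :=
    (((hloc.deriv (Eventually.of_forall fun n => (hφ n).diff) isOpen_ball).tendsto_at hz).comp
      (tendsto_add_atTop_nat 1))
  have h3 : Tendsto (fun n => F (φ n z)) atTop (𝓝 (F (f z))) :=
    (hF _ (hfB z hz)).continuousAt.tendsto.comp (hf z hz)
  simp only [(hφd _ z hz).deriv] at h2
  rw [tendsto_nhds_unique h2 h3] at h1
  exact h1

end HolomorphicODE

/-! ### Real trajectories: uniqueness, continuation and change of time. -/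

section RealODE

variable {E : Type*} [NormedAddCommGroup E] [NormedSpace ℝ E]

/-- `γ` is an integral curve in `Ω` of the field `X` at all times in `I`. -/
def IsTrajectory (X : E → E) (Ω : Set E) (I : Set ℝ) (γ : ℝ → E) : Prop :=
  ∀ t ∈ I, γ t ∈ Ω ∧ HasDerivAt γ (X (γ t)) t

variable {X : E → E} {Ω : Set E}

theorem IsTrajectory.mono {I J : Set ℝ} {γ : ℝ → E} (h : IsTrajectory X Ω I γ) (hJ : J ⊆ I) :
    IsTrajectory X Ω J γ := fun t ht => h t (hJ ht)

theorem IsTrajectory.congr {I : Set ℝ} (hI : IsOpen I) {γ γ' : ℝ → E}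
    (h : IsTrajectory X Ω I γ) (he : EqOn γ' γ I) : IsTrajectory X Ω I γ' := by
  intro t ht
  have h1 : γ' =ᶠ[𝓝 t] γ := eventuallyEq_of_mem (hI.mem_nhds ht) he
  rw [he ht]
  exact ⟨(h t ht).1, (h t ht).2.congr_of_eventuallyEq h1⟩

theorem IsTrajectory.comp_sub_const {I : Set ℝ} {γ : ℝ → E} (h : IsTrajectory X Ω I γ) (c : ℝ) :
    IsTrajectory X Ω ((fun t => t - c) ⁻¹' I) (fun t => γ (t - c)) := fun t ht =>
  ⟨(h _ ht).1, (h _ ht).2.comp_sub_const t c⟩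

/-- Near a common point a Lipschitz bound gives local uniqueness. So the set where the germs agree
is open and, by continuity, relatively closed in the connected set `I`. -/
theorem IsTrajectory.eqOn (hX : ∀ x ∈ Ω, ContDiffAt ℝ 1 X x) {I : Set ℝ} (hI : IsOpen I)
    (hIc : I.OrdConnected) {γ η : ℝ → E} (hγ : IsTrajectory X Ω I γ) (hη : IsTrajectory X Ω I η)
    {t0 : ℝ} (ht0 : t0 ∈ I) (h0 : γ t0 = η t0) : EqOn γ η I := by
  have hloc : ∀ t ∈ I, γ t = η t → γ =ᶠ[𝓝 t] η := by
    intro t ht he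
    obtain ⟨K, s, hs, hK⟩ := (hX _ (hγ t ht).1).exists_lipschitzOnWith
    refine ODE_solution_unique_of_eventually (v := fun _ => X) (s := fun _ => s) (K := K)
      (Eventually.of_forall fun _ => hK) ?_ ?_ he
    · filter_upwards [hI.mem_nhds ht, (hγ t ht).2.continuousAt.preimage_mem_nhds hs]
        with u hu hu' using ⟨(hγ u hu).2, hu'⟩
    · rw [he] at hs
      filter_upwards [hI.mem_nhds ht, (hη t ht).2.continuousAt.preimage_mem_nhds hs]
        with u hu hu' using ⟨(hη u hu).2, hu'⟩
  have hsub : I ⊆ {t | γ =ᶠ[𝓝 t] η} := by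
    refine hIc.isPreconnected.subset_of_closure_inter_subset isOpen_setOfPred_eventually_nhds
      ⟨t0, ht0, hloc t0 ht0 h0⟩ ?_
    rintro t ⟨htc, ht⟩
    refine hloc t ht ?_
    have hfr : ∃ᶠ u in 𝓝 t, γ u = η u :=
      (mem_closure_iff_frequently.1 htc).mono fun u hu => hu.self_of_nhds
    have hc : ContinuousAt (fun u => γ u - η u) t :=
      (hγ t ht).2.continuousAt.sub (hη t ht).2.continuousAt
    by_contra hne
    exact hfr ((hc.eventually_ne (sub_ne_zero.2 hne)).mono fun u hu he => hu (sub_eq_zero.2 he))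
  exact fun t ht => (hsub ht).self_of_nhds

open Classical in
theorem IsTrajectory.exists_glue {I J : Set ℝ} (hI : IsOpen I) (hJ : IsOpen J) {γ η : ℝ → E}
    (hγ : IsTrajectory X Ω I γ) (hη : IsTrajectory X Ω J η) (he : EqOn γ η (I ∩ J)) :
    ∃ ξ, IsTrajectory X Ω (I ∪ J) ξ ∧ EqOn ξ γ I ∧ EqOn ξ η J := by
  have h1 : EqOn (I.piecewise γ η) γ I := piecewise_eqOn _ _ _
  have h2 : EqOn (I.piecewise γ η) η J := by
    intro t ht
    by_cases hti : t ∈ I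
    · rw [piecewise_eq_of_mem _ _ _ hti, he ⟨hti, ht⟩]
    · rw [piecewise_eq_of_notMem _ _ _ hti]
  refine ⟨I.piecewise γ η, fun t ht => ?_, h1, h2⟩
  rcases ht with ht | ht
  exacts [hγ.congr hI h1 t ht, hη.congr hJ h2 t ht]

theorem IsTrajectory.exists_extension (hX : ∀ x ∈ Ω, ContDiffAt ℝ 1 X x) {ρ : ℝ} (hρ : 0 < ρ)
    (hloc : ∀ x ∈ Ω, ∃ γ : ℝ → E, γ 0 = x ∧ IsTrajectory X Ω (Ioo (-ρ) ρ) γ)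
    {a b c : ℝ} (hc : c ∈ Ioo a b) {γ : ℝ → E} (hγ : IsTrajectory X Ω (Ioo a b) γ) :
    ∃ ξ, IsTrajectory X Ω (Ioo a b ∪ Ioo (c - ρ) (c + ρ)) ξ ∧ EqOn ξ γ (Ioo a b) := by
  obtain ⟨η, hη0, hη⟩ := hloc _ (hγ c hc).1
  have h1 : (fun t => t - c) ⁻¹' Ioo (-ρ) ρ = Ioo (c - ρ) (c + ρ) := by
    ext t; simp only [mem_preimage, mem_Ioo]; constructor <;> rintro ⟨_, _⟩ <;> constructor <;> linarith
  have h2 := hη.comp_sub_const c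
  rw [h1] at h2
  have h3 : EqOn γ (fun t => η (t - c)) (Ioo a b ∩ Ioo (c - ρ) (c + ρ)) :=
    IsTrajectory.eqOn hX (isOpen_Ioo.inter isOpen_Ioo) (ordConnected_Ioo.inter ordConnected_Ioo)
      (hγ.mono inter_subset_left) (h2.mono inter_subset_right)
      (t0 := c) ⟨hc, by constructor <;> linarith⟩ (by simp [hη0])
  obtain ⟨ξ, hξ, hξ', -⟩ := hγ.exists_glue isOpen_Ioo isOpen_Ioo h2 h3
  exact ⟨ξ, hξ, hξ'⟩

theorem exists_isTrajectory_Ioo (hX : ∀ x ∈ Ω, ContDiffAt ℝ 1 X x) {ρ : ℝ} (hρ : 0 < ρ)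
    (hloc : ∀ x ∈ Ω, ∃ γ : ℝ → E, γ 0 = x ∧ IsTrajectory X Ω (Ioo (-ρ) ρ) γ)
    {x : E} (hx : x ∈ Ω) (n : ℕ) :
    ∃ γ : ℝ → E, γ 0 = x ∧
      IsTrajectory X Ω (Ioo (-(ρ + n * (ρ / 2))) (ρ + n * (ρ / 2))) γ := by
  induction n with
  | zero => simpa using hloc x hx
  | succ n ih =>
    obtain ⟨γ, hγ0, hγ⟩ := ih
    set R := ρ + n * (ρ / 2) with hR
    have hRρ : ρ ≤ R := by have : 0 ≤ n * (ρ / 2) := by positivity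
                           linarith
    have hR' : ρ + ((n + 1 : ℕ) : ℝ) * (ρ / 2) = R + ρ / 2 := by rw [hR]; push_cast; ring
    -- Restarting at distance `ρ/2` inside an endpoint, with existence time `ρ`, gains `ρ/2` beyond
    -- it; this is done at each end.
    obtain ⟨γ1, h1, h1'⟩ := hγ.exists_extension hX hρ hloc (c := R - ρ / 2)
      (by constructor <;> linarith)
    have h1s := h1.mono (J := Ioo (-R) (R + ρ / 2)) (by
      rintro t ⟨_, _⟩
      by_cases h : t < R
      · left; constructor <;> assumption
      · right; constructor <;> linarith)
    obtain ⟨γ2, h2, h2'⟩ := h1s.exists_extension hX hρ hloc (c := -(R - ρ / 2))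
      (by constructor <;> linarith)
    refine ⟨γ2, ?_, hR' ▸ h2.mono ?_⟩
    · rw [h2' (by constructor <;> linarith), h1' (by constructor <;> linarith), hγ0]
    · rintro t ⟨_, _⟩
      by_cases h : -R < t
      · left; constructor <;> assumption
      · right; constructor <;> linarith

/-- If the local existence time is bounded below, then trajectories exist for all time. -/
theorem exists_isTrajectory_univ (hX : ∀ x ∈ Ω, ContDiffAt ℝ 1 X x) {ρ : ℝ} (hρ : 0 < ρ)
    (hloc : ∀ x ∈ Ω, ∃ γ : ℝ → E, γ 0 = x ∧ IsTrajectory X Ω (Ioo (-ρ) ρ) γ)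
    {x : E} (hx : x ∈ Ω) : ∃ γ : ℝ → E, γ 0 = x ∧ IsTrajectory X Ω univ γ := by
  choose γ hγ0 hγ using exists_isTrajectory_Ioo hX hρ hloc hx
  set R : ℕ → ℝ := fun n => ρ + n * (ρ / 2) with hR
  have hRpos : ∀ n, 0 < R n := fun n => by positivity
  have hmono : ∀ {n m : ℕ}, n ≤ m → R n ≤ R m := by
    intro n m h; simp only [hR]; gcongr
  have hle : ∀ {n m : ℕ}, n ≤ m → EqOn (γ n) (γ m) (Ioo (-R n) (R n)) := by
    intro n m h
    refine (hγ n).eqOn hX isOpen_Ioo ordConnected_Ioo ((hγ m).mono ?_) (t0 := 0) ?_ ?_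
    · exact Ioo_subset_Ioo (neg_le_neg (hmono h)) (hmono h)
    · exact ⟨neg_lt_zero.2 (hRpos n), hRpos n⟩
    · rw [hγ0, hγ0]
  have hag : ∀ n m t, |t| < R n → |t| < R m → γ n t = γ m t := by
    intro n m t hn hm
    rcases le_total n m with h | h
    · exact hle h (abs_lt.1 hn)
    · exact (hle h (abs_lt.1 hm)).symm
  have hex : ∀ t : ℝ, ∃ n, |t| < R n := by
    intro t
    obtain ⟨n, hn⟩ := exists_nat_gt (|t| / (ρ / 2))
    refine ⟨n, ?_⟩
    rw [div_lt_iff₀ (by positivity)] at hn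
    simp only [hR]; linarith
  choose k hk using hex
  refine ⟨fun t => γ (k t) t, hγ0 _, fun t _ => ?_⟩
  have hev : (fun u => γ (k u) u) =ᶠ[𝓝 t] γ (k t) := by
    filter_upwards [continuous_abs.continuousAt.eventually (gt_mem_nhds (hk t))] with u hu
    exact hag _ _ _ (hk u) hu
  have := hγ (k t) t (abs_lt.1 (hk t))
  exact ⟨this.1, this.2.congr_of_eventuallyEq hev⟩

/-- A maximal trajectory of `f` is, in the time `θ(t) = ∫₀ᵗ s⁻¹`, the global trajectory of
`s • f`. -/
theorem bijOn_fictitiousTime_of_global {f : E → E} {s : E → ℝ}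
    (hf : ∀ x ∈ Ω, ContDiffAt ℝ 1 f x) (hs : ∀ x ∈ Ω, ContinuousAt s x) (hpos : ∀ x ∈ Ω, 0 < s x)
    {Γ : ℝ → E} (hΓ : IsTrajectory (fun x => s x • f x) Ω univ Γ)
    {I : Set ℝ} (hI : IsOpen I) (hIc : I.OrdConnected) (h0 : (0 : ℝ) ∈ I) {γ : ℝ → E}
    (hγ : IsTrajectory f Ω I γ) (hγ0 : γ 0 = Γ 0)
    (hmax : ∀ (J : Set ℝ) (η : ℝ → E), IsOpen J → J.OrdConnected → I ⊆ J →
      IsTrajectory f Ω J η → EqOn η γ I → J = I) :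
    BijOn (fun t => ∫ u in (0 : ℝ)..t, (s (γ u))⁻¹) I univ ∧
      ∀ t ∈ I, Γ (∫ u in (0 : ℝ)..t, (s (γ u))⁻¹) = γ t := by
  have hsΓ : Continuous fun τ => s (Γ τ) := continuous_iff_continuousAt.2 fun τ =>
    (hs _ (hΓ τ trivial).1).comp (hΓ τ trivial).2.continuousAt
  -- `T` expresses physical time through fictitious time and will turn out to be the inverse of `θ`.
  set T : ℝ → ℝ := fun τ => ∫ u in (0 : ℝ)..τ, s (Γ u) with hT
  have hTd : ∀ τ, HasStrictDerivAt T (s (Γ τ)) τ := fun τ =>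
    hsΓ.integral_hasStrictDerivAt 0 τ
  have hsp : ∀ τ, 0 < s (Γ τ) := fun τ => hpos _ (hΓ τ trivial).1
  have hTmono : StrictMono T := strictMono_of_deriv_pos fun τ => by
    rw [(hTd τ).hasDerivAt.deriv]; exact hsp τ
  have hTc : Continuous T := continuous_iff_continuousAt.2 fun τ => (hTd τ).hasDerivAt.continuousAt
  have hT0 : T 0 = 0 := by simp [hT]
  have hJo : IsOpen (range T) :=
    (isOpenMap_of_hasStrictDerivAt hTd fun τ => (hsp τ).ne').isOpen_range
  have hJc : (range T).OrdConnected := (isPreconnected_range hTc).ordConnected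
  obtain ⟨S, hS⟩ := hTmono.injective.hasLeftInverse
  -- Since the inverse `S` of `T` has derivative `1/s`, running `Γ` in the time `T` removes the
  -- factor `s`.
  have hη : IsTrajectory f Ω (range T) (fun t => Γ (S t)) := by
    rintro _ ⟨τ, rfl⟩
    have h1 := ((hTd τ).to_local_left_inverse (hsp τ).ne'
      (Eventually.of_forall hS)).hasDerivAt
    have h2 := (hΓ τ trivial).2
    have h3 : Γ (S (T τ)) = Γ τ := by rw [hS]
    rw [← hS τ] at h2
    have h4 := h2.scomp (T τ) h1
    simp only [h3] at h4 ⊢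
    refine ⟨(hΓ τ trivial).1, ?_⟩
    rw [smul_smul, inv_mul_cancel₀ (hsp τ).ne', one_smul] at h4
    exact h4
  have h0J : (0 : ℝ) ∈ range T := ⟨0, hT0⟩
  have hS0 : S 0 = 0 := by rw [← hT0, hS, hT0]
  have hagree : EqOn γ (fun t => Γ (S t)) (I ∩ range T) :=
    IsTrajectory.eqOn hf (hI.inter hJo) (hIc.inter hJc) (hγ.mono inter_subset_left)
      (hη.mono inter_subset_right) (t0 := 0) ⟨h0, h0J⟩ (by simp [hS0, hγ0])
  obtain ⟨ξ, hξ, hξ', -⟩ := hγ.exists_glue hI hJo hη hagree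
  -- Here maximality enters: the glued solution lives on `I ∪ range T`, which must therefore be `I`.
  have hsub : range T ⊆ I := by
    rw [← hmax _ ξ (hI.union hJo)
      (hIc.isPreconnected.union 0 h0 h0J hJc.isPreconnected).ordConnected subset_union_left hξ hξ']
    exact subset_union_right
  have hγT : ∀ τ, γ (T τ) = Γ τ := fun τ => by
    have h1 := hagree ⟨hsub ⟨τ, rfl⟩, τ, rfl⟩
    simpa only [hS τ] using h1
  set θ : ℝ → ℝ := fun t => ∫ u in (0 : ℝ)..t, (s (γ u))⁻¹ with hθ
  have hcI : ContinuousOn (fun u => (s (γ u))⁻¹) I := fun u hu =>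
    (((hs _ (hγ u hu).1).comp (hγ u hu).2.continuousAt).inv₀
      (hpos _ (hγ u hu).1).ne').continuousWithinAt
  have hθd : ∀ t ∈ I, HasDerivAt θ (s (γ t))⁻¹ t := by
    intro t ht
    refine intervalIntegral.integral_hasDerivAt_right ?_ ?_ (hcI.continuousAt (hI.mem_nhds ht))
    · exact (hcI.mono (hIc.uIcc_subset h0 ht)).intervalIntegrable
    · exact hcI.stronglyMeasurableAtFilter hI t ht
  -- The derivative of `θ ∘ T` is `s⁻¹ s = 1`. This gives surjectivity of `θ`; injectivity follows
  -- from `θ' = s⁻¹ > 0`.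
  have hθT : ∀ τ, θ (T τ) = τ := by
    have hd : ∀ τ, HasDerivAt (fun τ => θ (T τ) - τ) 0 τ := by
      intro τ
      have h1 := ((hθd _ (hsub ⟨τ, rfl⟩)).comp τ (hTd τ).hasDerivAt).sub (hasDerivAt_id τ)
      rw [hγT, inv_mul_cancel₀ (hsp τ).ne', sub_self] at h1
      exact h1
    intro τ
    have h1 := is_const_of_deriv_eq_zero (fun τ => (hd τ).differentiableAt)
      (fun τ => (hd τ).deriv) τ 0
    have h2 : θ 0 = 0 := by simp [hθ]
    simp only [hT0, h2, sub_self] at h1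
    exact sub_eq_zero.1 h1
  have hinj : InjOn θ I := by
    refine StrictMonoOn.injOn (strictMonoOn_of_deriv_pos hIc.convex
      (fun t ht => (hθd t ht).continuousAt.continuousWithinAt) fun t ht => ?_)
    rw [(hθd t (interior_subset ht)).deriv]
    exact inv_pos.2 (hpos _ (hγ t (interior_subset ht)).1)
  refine ⟨⟨fun _ _ => trivial, hinj, fun τ _ => ⟨T τ, hsub ⟨τ, rfl⟩, hθT τ⟩⟩, fun t ht => ?_⟩
  have h1 : T (θ t) = t := hinj (hsub ⟨_, rfl⟩) ht (hθT _)
  change Γ (θ t) = γ t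
  rw [← hγT, h1]

end RealODE

/-! ### The identity theorem along the real axis and gluing of discs into a strip. -/

section ComplexGlue

variable {E : Type*} [NormedAddCommGroup E] [NormedSpace ℂ E]

theorem eqOn_of_eventually_real_eq {F G : ℂ → E} {U : Set ℂ} (hU : IsPreconnected U)
    (hF : AnalyticOnNhd ℂ F U) (hG : AnalyticOnNhd ℂ G U) {a : ℝ} (ha : (a : ℂ) ∈ U)
    (h : ∀ᶠ t : ℝ in 𝓝 a, F t = G t) : EqOn F G U := by
  refine hF.eqOn_of_preconnected_of_frequently_eq hG hU ha ?_
  have h1 : Tendsto (fun t : ℝ => (t : ℂ)) (𝓝[≠] a) (𝓝[≠] (a : ℂ)) := by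
    refine tendsto_nhdsWithin_iff.2 ⟨?_, ?_⟩
    · exact (Complex.continuous_ofReal.tendsto a).mono_left nhdsWithin_le_nhds
    · filter_upwards [self_mem_nhdsWithin] with t ht h
      exact ht (Complex.ofReal_injective h)
  exact h1.frequently (h.filter_mono nhdsWithin_le_nhds).frequently

/-- Holomorphic continuations of a curve to discs of a fixed radius around all points of the real
axis combine to a holomorphic continuation to a strip. -/
theorem exists_analyticOnNhd_strip [CompleteSpace E] {g : ℝ → E} {ρ : ℝ} (hρ : 0 < ρ)
    (h : ∀ τ : ℝ, ∃ f : ℂ → E, DifferentiableOn ℂ f (ball 0 ρ) ∧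
      ∀ t : ℝ, |t| < ρ → f t = g (τ + t)) :
    ∃ F : ℂ → E, AnalyticOnNhd ℂ F {z | |z.im| < ρ} ∧ ∀ t : ℝ, F t = g t := by
  choose f hf hfg using h
  have han : ∀ c : ℝ, AnalyticOnNhd ℂ (fun z => f c (z - c)) (ball (c : ℂ) ρ) := by
    intro c
    refine DifferentiableOn.analyticOnNhd ?_ isOpen_ball
    refine (hf c).comp (by fun_prop) fun z hz => ?_
    rwa [mem_ball_zero_iff, ← mem_ball_iff_norm]
  -- Each `z` uses the disc centred at its own real part. Near `z0` this agrees with the single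
  -- function centred at `Re z0`: the two discs meet in a convex set that contains the real point
  -- `Re z`, and both functions continue `g` there.
  refine ⟨fun z => f z.re (z - z.re), fun z0 hz0 => ?_, fun t => ?_⟩
  · have hball : ∀ z : ℂ, |z.im| < ρ → z ∈ ball ((z.re : ℝ) : ℂ) ρ := by
      intro z hz
      have : z - z.re = z.im * Complex.I := by
        apply Complex.ext <;> simp
      rw [mem_ball_iff_norm, this]
      simpa using hz
    have hz0' : z0 ∈ ball ((z0.re : ℝ) : ℂ) ρ := hball z0 hz0
    refine (han z0.re z0 hz0').congr ?_
    have hop : IsOpen {z : ℂ | |z.im| < ρ} :=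
      isOpen_lt (by fun_prop) continuous_const
    filter_upwards [isOpen_ball.mem_nhds hz0', hop.mem_nhds hz0] with z hz hz1
    have hz2 := hball z hz1
    have hre : ((z.re : ℝ) : ℂ) ∈ ball ((z0.re : ℝ) : ℂ) ρ := by
      rw [mem_ball_iff_norm] at hz ⊢
      refine lt_of_le_of_lt ?_ hz
      rw [← Complex.ofReal_sub, Complex.norm_real]
      simpa using Complex.abs_re_le_norm (z - z0.re)
    refine eqOn_of_eventually_real_eq (U := ball ((z0.re : ℝ) : ℂ) ρ ∩ ball ((z.re : ℝ) : ℂ) ρ)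
      ((convex_ball _ _).inter (convex_ball _ _)).isPreconnected
      ((han _).mono inter_subset_left) ((han _).mono inter_subset_right)
      (a := z.re) ⟨hre, mem_ball_self hρ⟩ ?_ ⟨hz, hz2⟩
    have hc := Complex.continuous_ofReal.continuousAt (x := z.re)
    filter_upwards [hc.eventually (isOpen_ball.mem_nhds hre),
      hc.eventually (isOpen_ball.mem_nhds (mem_ball_self hρ))] with t h1 h2
    rw [dist_eq_norm, ← Complex.ofReal_sub, Complex.norm_real] at h1 h2
    rw [← Complex.ofReal_sub, ← Complex.ofReal_sub, hfg _ _ h1, hfg _ _ h2]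
    simp
  · have := hfg t 0 (by simpa using hρ)
    simpa using this

end ComplexGlue

/-! ### The complexified renormalized field and its regularity. -/

section ComplexField

/-- The inclusion `ℝ³ ⊆ ℂ³`. -/
def complexifyVec (x : E3) : C3 := WithLp.toLp 2 (fun k => ((x k : ℝ) : ℂ))

@[simp] theorem complexifyVec_apply (x : E3) (k : Fin 3) : complexifyVec x k = (x k : ℂ) := rfl

theorem complexify_apply {N : ℕ} (x : Config N) (i : Fin N) :
    complexify x i = complexifyVec (x i) := rfl

theorem complexifyVec_sub (x y : E3) :
    complexifyVec (x - y) = complexifyVec x - complexifyVec y := by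
  ext k; simp

theorem complexifyVec_smul (c : ℝ) (x : E3) :
    complexifyVec (c • x) = (c : ℂ) • complexifyVec x := by
  ext k; simp

theorem complexifyVec_sum {ι : Type*} (s : Finset ι) (f : ι → E3) :
    complexifyVec (∑ i ∈ s, f i) = ∑ i ∈ s, complexifyVec (f i) := by
  ext k; simp

theorem norm_complexifyVec (x : E3) : ‖complexifyVec x‖ = ‖x‖ := by
  simp [EuclideanSpace.norm_eq]

/-- The bilinear extension to `ℂ³` of the scalar product. -/
def bil (x y : C3) : ℂ := ∑ k, x k * y k

theorem norm_bil_le (x y : C3) : ‖bil x y‖ ≤ ‖x‖ * ‖y‖ := by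
  calc ‖bil x y‖ ≤ ∑ k, ‖x k‖ * ‖y k‖ := by
        refine (norm_sum_le _ _).trans (le_of_eq ?_)
        simp
    _ ≤ ‖x‖ * ‖y‖ := by
        rw [EuclideanSpace.norm_eq, EuclideanSpace.norm_eq]
        exact Real.sum_mul_le_sqrt_mul_sqrt _ _ _

theorem norm_bil_self_sub_le (x y : C3) :
    ‖bil x x - bil y y‖ ≤ 2 * ‖y‖ * ‖x - y‖ + ‖x - y‖ ^ 2 := by
  have h : bil x x - bil y y = 2 * bil y (x - y) + bil (x - y) (x - y) := by
    simp only [bil, Finset.mul_sum, ← Finset.sum_sub_distrib, ← Finset.sum_add_distrib]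
    refine Finset.sum_congr rfl fun k _ => ?_
    simp only [PiLp.sub_apply]; ring
  rw [h]
  refine (norm_add_le _ _).trans ?_
  rw [norm_mul, Complex.norm_two, mul_assoc, pow_two]
  exact add_le_add (mul_le_mul_of_nonneg_left (norm_bil_le _ _) zero_le_two) (norm_bil_le _ _)

theorem bil_complexifyVec (x : E3) :
    bil (complexifyVec x) (complexifyVec x) = ((‖x‖ ^ 2 : ℝ) : ℂ) := by
  rw [EuclideanSpace.real_norm_sq_eq, bil]
  push_cast
  simp [pow_two]

/-- The principal branch of `w ↦ w^(-1/2)`. -/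
def invSqrt (w : ℂ) : ℂ := w ^ (-(1 / 2) : ℂ)

theorem invSqrt_ofReal {x : ℝ} (hx : 0 ≤ x) :
    invSqrt (x : ℂ) = ((x ^ (-(1 / 2) : ℝ) : ℝ) : ℂ) := by
  rw [invSqrt, Complex.ofReal_cpow hx]
  push_cast; rfl

theorem invSqrt_ofReal_sq {x : ℝ} (hx : 0 ≤ x) : invSqrt ((x ^ 2 : ℝ) : ℂ) = ((1 / x : ℝ) : ℂ) := by
  rw [invSqrt_ofReal (sq_nonneg x), ← Real.rpow_natCast, ← Real.rpow_mul hx]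
  norm_num [Real.rpow_neg_one]

theorem invSqrt_sq {w : ℂ} (hw : w ≠ 0) : invSqrt w ^ 2 = w⁻¹ := by
  rw [invSqrt, pow_two, ← Complex.cpow_add _ _ hw]
  norm_num [Complex.cpow_neg_one]

/-- The argument of `w` lies in `(-π/2, π/2)`, and the power `-1/2` halves it in absolute value. -/
theorem invSqrt_re_pos {w : ℂ} (hw : 0 < w.re) : 0 < (invSqrt w).re := by
  have h0 : w ≠ 0 := by rintro rfl; simp at hw
  have h1 := Complex.abs_arg_lt_pi_div_two_iff.2 (Or.inl hw)
  rw [invSqrt, Complex.cpow_def_of_ne_zero h0, Complex.exp_re]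
  refine mul_pos (Real.exp_pos _) (Real.cos_pos_of_mem_Ioo ?_)
  have h2 : (Complex.log w * -(1 / 2)).im = -(w.arg / 2) := by
    have : (-(1 / 2) : ℂ) = ((-(1 / 2) : ℝ) : ℂ) := by push_cast; rfl
    rw [this, Complex.im_mul_ofReal, Complex.log_im]; ring
  rw [h2]
  have := abs_lt.1 h1
  constructor <;> linarith [Real.pi_pos]

theorem contDiffAt_invSqrt {w : ℂ} (hw : 0 < w.re) : ContDiffAt ℂ 1 invSqrt w :=
  (analyticAt_id.cpow analyticAt_const (Or.inl hw)).contDiffAt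

variable {N : ℕ}

/-- The function `s⁻²`. -/
def invSqS (G : ℝ) (m : Fin N → ℝ) (q v : Config N) : ℝ :=
  (∑ i, ∑ j ∈ Finset.Ioi i, (‖v i - v j‖ / ‖q i - q j‖) ^ 2) +
    invDistSum q * (∑ i, ∑ j ∈ Finset.Ioi i, G * (m i + m j) / ‖q i - q j‖ ^ 2)

theorem sAlt_eq (G : ℝ) (m : Fin N → ℝ) (q v : Config N) :
    sAlt G m q v = invSqS G m q v ^ (-(1 / 2) : ℝ) := rfl

/-- The complexification of `A`. -/
def cInvDistSum (q : CConfig N) : ℂ :=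
  ∑ i, ∑ j ∈ Finset.Ioi i, invSqrt (bil (q i - q j) (q i - q j))

/-- The complexification of `s⁻²`. -/
def cInvSqS (G : ℝ) (m : Fin N → ℝ) (q v : CConfig N) : ℂ :=
  (∑ i, ∑ j ∈ Finset.Ioi i, bil (v i - v j) (v i - v j) * (bil (q i - q j) (q i - q j))⁻¹) +
    cInvDistSum q *
      (∑ i, ∑ j ∈ Finset.Ioi i, ((G * (m i + m j) : ℝ) : ℂ) * (bil (q i - q j) (q i - q j))⁻¹)

/-- The complexification of the accelerations. -/
def cAccel (G : ℝ) (m : Fin N → ℝ) (q : CConfig N) : CConfig N :=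
  fun i => ∑ j ∈ Finset.univ.erase i,
    (((G * m j : ℝ) : ℂ) * (invSqrt (bil (q i - q j) (q i - q j)) *
      (bil (q i - q j) (q i - q j))⁻¹)) • (q j - q i)

/-- The renormalized field on the complexified phase space. -/
def cField (G : ℝ) (m : Fin N → ℝ) (x : CConfig N × CConfig N) : CConfig N × CConfig N :=
  invSqrt (cInvSqS G m x.1 x.2) • (x.2, cAccel G m x.1)

/-- The field of the `N`-body equations. -/
def physField (G : ℝ) (m : Fin N → ℝ) (x : Config N × Config N) : Config N × Config N :=
  (x.2, accel G m x.1)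

/-- The inclusion of the phase space into its complexification. -/
def complexifyPhase (x : Config N × Config N) : CConfig N × CConfig N :=
  (complexify x.1, complexify x.2)

/-- Phase points without collisions. -/
def regularSet (N : ℕ) : Set (Config N × Config N) := {x | x.1 ∉ collisionSet N}

theorem ne_of_notMem_collisionSet {q : Config N} (hq : q ∉ collisionSet N) {i j : Fin N}
    (h : i ≠ j) : q i ≠ q j := fun he => hq ⟨i, j, h, he⟩

theorem norm_sub_pos_of_notMem {q : Config N} (hq : q ∉ collisionSet N) {i j : Fin N}
    (h : i ≠ j) : 0 < ‖q i - q j‖ :=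
  norm_pos_iff.2 (sub_ne_zero.2 (ne_of_notMem_collisionSet hq h))

theorem cInvSqS_complexify (G : ℝ) (m : Fin N → ℝ) (q v : Config N) :
    cInvSqS G m (complexify q) (complexify v) = (invSqS G m q v : ℂ) := by
  simp only [cInvSqS, cInvDistSum, complexify_apply, ← complexifyVec_sub, bil_complexifyVec,
    invSqrt_ofReal_sq (norm_nonneg _), invSqS, invDistSum]
  push_cast
  simp only [div_eq_mul_inv, mul_pow, inv_pow]

theorem cAccel_complexify (G : ℝ) (m : Fin N → ℝ) (q : Config N) :
    cAccel G m (complexify q) = complexify (accel G m q) := by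
  funext i
  simp only [cAccel, complexify_apply, accel, complexifyVec_sum, complexifyVec_smul,
    ← complexifyVec_sub, bil_complexifyVec, invSqrt_ofReal_sq (norm_nonneg _)]
  refine Finset.sum_congr rfl fun j _ => ?_
  congr 1
  push_cast
  ring

theorem complexify_smul (c : ℝ) (x : Config N) : complexify (c • x) = (c : ℂ) • complexify x := by
  funext i
  simp [complexify_apply, complexifyVec_smul]

theorem cField_complexifyPhase (G : ℝ) (m : Fin N → ℝ) (x : Config N × Config N)
    (hx : 0 ≤ invSqS G m x.1 x.2) :
    cField G m (complexifyPhase x) = complexifyPhase (sAlt G m x.1 x.2 • physField G m x) := by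
  simp only [cField, complexifyPhase, physField, Prod.smul_mk, complexify_smul, cAccel_complexify,
    cInvSqS_complexify, invSqrt_ofReal hx, sAlt_eq]

theorem contDiff_bil_self (i j : Fin N) :
    ContDiff ℂ 1 (fun q : CConfig N => bil (q i - q j) (q i - q j)) := by
  unfold bil
  simp only [PiLp.sub_apply]
  fun_prop

/-- Positive real parts keep the squared distances and `s⁻²` away from 0 and from the cut of the
principal branch. -/
theorem contDiffAt_cField (G : ℝ) (m : Fin N → ℝ) {x : CConfig N × CConfig N}
    (hq : ∀ i j, i ≠ j → 0 < (bil (x.1 i - x.1 j) (x.1 i - x.1 j)).re)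
    (hs : 0 < (cInvSqS G m x.1 x.2).re) : ContDiffAt ℂ 1 (cField G m) x := by
  have hb : ∀ i j, ContDiffAt ℂ 1
      (fun x : CConfig N × CConfig N => bil (x.1 i - x.1 j) (x.1 i - x.1 j)) x := fun i j =>
    ((contDiff_bil_self i j).comp contDiff_fst).contDiffAt
  have hv : ∀ i j, ContDiffAt ℂ 1
      (fun x : CConfig N × CConfig N => bil (x.2 i - x.2 j) (x.2 i - x.2 j)) x := fun i j =>
    ((contDiff_bil_self i j).comp contDiff_snd).contDiffAt
  have hi : ∀ i j, i ≠ j → ContDiffAt ℂ 1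
      (fun x : CConfig N × CConfig N => (bil (x.1 i - x.1 j) (x.1 i - x.1 j))⁻¹) x :=
    fun i j h => (hb i j).inv (by intro h0; have := hq i j h; simp [h0] at this)
  have hr : ∀ i j, i ≠ j → ContDiffAt ℂ 1
      (fun x : CConfig N × CConfig N => invSqrt (bil (x.1 i - x.1 j) (x.1 i - x.1 j))) x :=
    fun i j h => ContDiffAt.comp (g := invSqrt) x (contDiffAt_invSqrt (hq i j h)) (hb i j)
  have hS : ContDiffAt ℂ 1 (fun x : CConfig N × CConfig N => cInvSqS G m x.1 x.2) x := by
    unfold cInvSqS cInvDistSum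
    refine ContDiffAt.add ?_ (ContDiffAt.mul ?_ ?_) <;>
      refine ContDiffAt.sum fun i _ => ContDiffAt.sum fun j hj => ?_
    · exact (hv i j).mul (hi i j (Finset.mem_Ioi.1 hj).ne)
    · exact hr i j (Finset.mem_Ioi.1 hj).ne
    · exact contDiffAt_const.mul (hi i j (Finset.mem_Ioi.1 hj).ne)
  have hS' : ContDiffAt ℂ 1
      (fun x : CConfig N × CConfig N => invSqrt (cInvSqS G m x.1 x.2)) x :=
    ContDiffAt.comp (g := invSqrt) x (contDiffAt_invSqrt hs) hS
  suffices hA : ContDiffAt ℂ 1 (fun x : CConfig N × CConfig N => cAccel G m x.1) x from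
    hS'.smul (contDiffAt_snd.prodMk hA)
  refine contDiffAt_pi.2 fun i => ContDiffAt.sum fun j hj => ?_
  have hij := (Finset.ne_of_mem_erase hj).symm
  refine ContDiffAt.smul (contDiffAt_const.mul ((hr i j hij).mul (hi i j hij))) ?_
  fun_prop

section RealSmooth

variable {n : WithTop ℕ∞}

theorem contDiffAt_norm_sub {q : Config N × Config N} {i j : Fin N} (h : q.1 i ≠ q.1 j) :
    ContDiffAt ℝ n (fun x : Config N × Config N => ‖x.1 i - x.1 j‖) q := by
  refine ContDiffAt.norm ℝ ?_ (sub_ne_zero.2 h)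
  fun_prop

theorem contDiffAt_physField (G : ℝ) (m : Fin N → ℝ) {x : Config N × Config N}
    (hx : x ∈ regularSet N) : ContDiffAt ℝ n (physField G m) x := by
  refine contDiffAt_snd.prodMk (contDiffAt_pi.2 fun i => ContDiffAt.sum fun j hj => ?_)
  have hij := (Finset.ne_of_mem_erase hj).symm
  refine ContDiffAt.smul (contDiffAt_const.div
    ((contDiffAt_norm_sub (ne_of_notMem_collisionSet hx hij)).pow 3)
    (pow_pos (norm_sub_pos_of_notMem hx hij) 3).ne') ?_
  fun_prop

/-- The order `n` is left free because it is needed both for `n = 1` (uniqueness for the equations)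
and for `n = ω` (real-analyticity of `s`). -/
theorem contDiffAt_sAlt (G : ℝ) (m : Fin N → ℝ) {x : Config N × Config N}
    (hx : x ∈ regularSet N) (hpos : 0 < invSqS G m x.1 x.2) :
    ContDiffAt ℝ n (fun x : Config N × Config N => sAlt G m x.1 x.2) x := by
  refine ContDiffAt.rpow_const_of_ne ?_ hpos.ne'
  have ha : ∀ i, ∀ j ∈ Finset.Ioi i, ContDiffAt ℝ n
      (fun x : Config N × Config N => ‖x.1 i - x.1 j‖) x := fun i j hj =>
    contDiffAt_norm_sub (ne_of_notMem_collisionSet hx (Finset.mem_Ioi.1 hj).ne)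
  have ha0 : ∀ i, ∀ j ∈ Finset.Ioi i, 0 < ‖x.1 i - x.1 j‖ := fun i j hj =>
    norm_sub_pos_of_notMem hx (Finset.mem_Ioi.1 hj).ne
  unfold invDistSum
  refine ContDiffAt.add ?_ (ContDiffAt.mul ?_ ?_) <;>
    refine ContDiffAt.sum fun i _ => ContDiffAt.sum fun j hj => ?_
  · simp only [div_pow]
    refine ContDiffAt.div ?_ ((ha i j hj).pow 2) (pow_pos (ha0 i j hj) 2).ne'
    refine ContDiffAt.norm_sq ℝ ?_
    fun_prop
  · exact contDiffAt_const.div (ha i j hj) (ha0 i j hj).ne'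
  · exact contDiffAt_const.div ((ha i j hj).pow 2) (pow_pos (ha0 i j hj) 2).ne'

end RealSmooth

end ComplexField

/-! ### Perturbation constants and the basic inequalities for `s⁻²`. -/

section Estimates

/-- The tolerance is `0.177225 = 2 · 0.085 + 0.085²`, the relative error of a square under an 8.5%
perturbation. With `y` the square root of `w` of positive real part, `(Re y)² ≥ Re w ≥ 0.822775 a²`
gives `Re y ≥ 0.907 a`, and `|a - y| |a + y| = |a² - w|` then bounds `|a - y|`. The remaining
constants are roundings of `1/0.822775`, `1/0.907` and the resulting products. -/
theorem invSqrt_estimates {a : ℝ} (ha : 0 < a) {w : ℂ}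
    (hw : ‖w - ((a ^ 2 : ℝ) : ℂ)‖ ≤ 0.177225 * a ^ 2) :
    0 < w.re ∧ ‖w⁻¹‖ ≤ 1.2154 / a ^ 2 ∧ ‖w⁻¹ - ((1 / a ^ 2 : ℝ) : ℂ)‖ ≤ 0.2154 / a ^ 2 ∧
      ‖invSqrt w‖ ≤ 1.1026 / a ∧ ‖invSqrt w - ((1 / a : ℝ) : ℂ)‖ ≤ 0.1025 / a := by
  have ha2 : 0 < a ^ 2 := by positivity
  have hre : 0.822775 * a ^ 2 ≤ w.re := by
    have h1 := (abs_le.1 ((Complex.abs_re_le_norm _).trans hw)).1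
    rw [Complex.sub_re, Complex.ofReal_re] at h1
    linarith
  have hre0 : 0 < w.re := lt_of_lt_of_le (by positivity) hre
  have hw0 : w ≠ 0 := by rintro rfl; simp at hre0
  have hnw : 0.822775 * a ^ 2 ≤ ‖w‖ := hre.trans (Complex.re_le_norm w)
  have hinv : ‖w⁻¹‖ ≤ 1.2154 / a ^ 2 := by
    rw [norm_inv, inv_eq_one_div, div_le_div_iff₀ (by positivity) ha2]
    nlinarith
  set r := invSqrt w with hr
  have hr0 : 0 < r.re := invSqrt_re_pos hre0
  have hrne : r ≠ 0 := by intro h; rw [h] at hr0; simp at hr0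
  have hr2 : r ^ 2 = w⁻¹ := invSqrt_sq hw0
  set y := r⁻¹ with hy
  have hyr : r = y⁻¹ := by rw [hy, inv_inv]
  have hyne : y ≠ 0 := inv_ne_zero hrne
  have hy2 : y ^ 2 = w := by rw [hy, inv_pow, hr2, inv_inv]
  have hyre : 0 < y.re := by
    rw [hy, Complex.inv_re]
    exact div_pos hr0 (Complex.normSq_pos.2 hrne)
  have hyre' : 0.907 * a ≤ y.re := by
    have h1 : w.re = y.re ^ 2 - y.im ^ 2 := by
      rw [← hy2, pow_two, Complex.mul_re]; ring
    refine (sq_le_sq₀ (by positivity) hyre.le).1 ?_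
    nlinarith [sq_nonneg y.im]
  have hyn : 0.907 * a ≤ ‖y‖ := hyre'.trans (Complex.re_le_norm y)
  have hay : 1.907 * a ≤ ‖(a : ℂ) + y‖ := by
    refine le_trans ?_ (Complex.re_le_norm _)
    rw [Complex.add_re, Complex.ofReal_re]
    linarith
  have hsub : ‖(a : ℂ) - y‖ ≤ 0.09295 * a := by
    have h1 : ‖(a : ℂ) - y‖ * ‖(a : ℂ) + y‖ ≤ 0.177225 * a ^ 2 := by
      rw [← norm_mul, ← norm_neg]
      refine le_trans (le_of_eq ?_) hw
      congr 1
      rw [← hy2]; push_cast; ring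
    have h2 : ‖(a : ℂ) - y‖ * (1.907 * a) ≤ 0.177225 * a ^ 2 :=
      (mul_le_mul_of_nonneg_left hay (norm_nonneg _)).trans h1
    have h3 : ‖(a : ℂ) - y‖ * 1.907 ≤ 0.177225 * a := by
      refine le_of_mul_le_mul_right ?_ ha
      linarith
    linarith
  have hac : (a : ℂ) ≠ 0 := by exact_mod_cast ha.ne'
  refine ⟨hre0, hinv, ?_, ?_, ?_⟩
  · have h1 : w⁻¹ - ((1 / a ^ 2 : ℝ) : ℂ) = -(w - ((a ^ 2 : ℝ) : ℂ)) * w⁻¹ * ((1 / a ^ 2 : ℝ) : ℂ) := by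
      push_cast; field_simp; ring
    rw [h1, norm_mul, norm_mul, norm_neg, Complex.norm_real, Real.norm_of_nonneg (by positivity)]
    calc ‖w - ((a ^ 2 : ℝ) : ℂ)‖ * ‖w⁻¹‖ * (1 / a ^ 2)
        ≤ (0.177225 * a ^ 2) * (1.2154 / a ^ 2) * (1 / a ^ 2) := by gcongr
      _ = 0.177225 * 1.2154 / a ^ 2 := by field_simp
      _ ≤ 0.2154 / a ^ 2 := by gcongr; norm_num
  · rw [hyr, norm_inv, inv_eq_one_div, div_le_div_iff₀ (by positivity) ha]
    linarith
  · have h1 : r - ((1 / a : ℝ) : ℂ) = ((a : ℂ) - y) * y⁻¹ * ((1 / a : ℝ) : ℂ) := by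
      rw [hyr]; push_cast; field_simp
    have h2 : ‖y⁻¹‖ ≤ 1.1026 / a := by
      rw [norm_inv, inv_eq_one_div, div_le_div_iff₀ (by positivity) ha]
      linarith
    rw [h1, norm_mul, norm_mul, Complex.norm_real, Real.norm_of_nonneg (by positivity)]
    calc ‖(a : ℂ) - y‖ * ‖y⁻¹‖ * (1 / a)
        ≤ (0.09295 * a) * (1.1026 / a) * (1 / a) := by
          gcongr
      _ = 0.09295 * 1.1026 / a := by field_simp
      _ ≤ 0.1025 / a := by gcongr; norm_num

theorem norm_bil_self_sub_le_of_near {u : E3} {x : C3}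
    (h : ‖x - complexifyVec u‖ ≤ 0.085 * ‖u‖) :
    ‖bil x x - ((‖u‖ ^ 2 : ℝ) : ℂ)‖ ≤ 0.177225 * ‖u‖ ^ 2 := by
  rw [← bil_complexifyVec]
  refine (norm_bil_self_sub_le _ _).trans ?_
  rw [norm_complexifyVec]
  nlinarith [norm_nonneg u, norm_nonneg (x - complexifyVec u)]

variable {N : ℕ}

theorem norm_sum_Ioi_sub_le {f g : Fin N → Fin N → ℂ} {h : Fin N → Fin N → ℝ}
    (H : ∀ i j, i < j → ‖f i j - g i j‖ ≤ h i j) :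
    ‖(∑ i, ∑ j ∈ Finset.Ioi i, f i j) - ∑ i, ∑ j ∈ Finset.Ioi i, g i j‖ ≤
      ∑ i, ∑ j ∈ Finset.Ioi i, h i j := by
  rw [← Finset.sum_sub_distrib]
  refine (norm_sum_le _ _).trans (Finset.sum_le_sum fun i _ => ?_)
  rw [← Finset.sum_sub_distrib]
  exact (norm_sum_le _ _).trans (Finset.sum_le_sum fun j hj => H i j (Finset.mem_Ioi.1 hj))

theorem le_sum_Ioi {f : Fin N → Fin N → ℝ} (hf : ∀ i j, 0 ≤ f i j) {i j : Fin N} (h : i < j) :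
    f i j ≤ ∑ i, ∑ j ∈ Finset.Ioi i, f i j :=
  (Finset.single_le_sum (f := fun j => f i j) (fun j _ => hf i j) (Finset.mem_Ioi.2 h)).trans
    (Finset.single_le_sum (f := fun i => ∑ j ∈ Finset.Ioi i, f i j)
      (fun i _ => Finset.sum_nonneg fun j _ => hf i j) (Finset.mem_univ i))

/-- The sum `∑_{i<j} G (m_i + m_j) / ‖q_i - q_j‖²`. -/
def gravSum (G : ℝ) (m : Fin N → ℝ) (q : Config N) : ℝ :=
  ∑ i, ∑ j ∈ Finset.Ioi i, G * (m i + m j) / ‖q i - q j‖ ^ 2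

/-- The sum `∑_{j≠i} G m_j / ‖q_i - q_j‖²`. -/
def gravRow (G : ℝ) (m : Fin N → ℝ) (q : Config N) (i : Fin N) : ℝ :=
  ∑ j ∈ Finset.univ.erase i, G * m j / ‖q i - q j‖ ^ 2

/-- The pair `{i, j}` gives its `m_j` part to row `i` and its `m_i` part to row `j`. Thus two
accelerations together are still controlled by one `gravSum`. -/
theorem gravSum_eq_sum_gravRow (G : ℝ) (m : Fin N → ℝ) (q : Config N) :
    gravSum G m q = ∑ i, gravRow G m q i := by
  have h := Finset.sum_sum_Ioi_add_eq_sum_sum_off_diag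
    (fun j i : Fin N => G * m j / ‖q i - q j‖ ^ 2)
  have h1 : ∀ i : Fin N, ({i}ᶜ : Finset (Fin N)) = Finset.univ.erase i := by
    intro i; ext j; simp
  simp only [h1] at h
  rw [gravSum]
  simp only [gravRow]
  rw [← h]
  refine Finset.sum_congr rfl fun i _ => Finset.sum_congr rfl fun j _ => ?_
  rw [norm_sub_rev (q j) (q i)]; ring

section Fixed

variable {G : ℝ} {m : Fin N → ℝ} {q : Config N}

theorem gravRow_nonneg (hG : 0 < G) (hm : ∀ i, 0 ≤ m i) (q : Config N) (i : Fin N) :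
    0 ≤ gravRow G m q i :=
  Finset.sum_nonneg fun j _ => div_nonneg (mul_nonneg hG.le (hm j)) (by positivity)

theorem gravRow_le_gravSum (hG : 0 < G) (hm : ∀ i, 0 ≤ m i) (q : Config N) (i : Fin N) :
    gravRow G m q i ≤ gravSum G m q := by
  rw [gravSum_eq_sum_gravRow]
  exact Finset.single_le_sum (fun j _ => gravRow_nonneg hG hm q j) (Finset.mem_univ i)

theorem gravRow_add_le_gravSum (hG : 0 < G) (hm : ∀ i, 0 ≤ m i) (q : Config N) {i j : Fin N}
    (h : i ≠ j) : gravRow G m q i + gravRow G m q j ≤ gravSum G m q := by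
  rw [gravSum_eq_sum_gravRow, ← Finset.sum_pair h]
  exact Finset.sum_le_sum_of_subset_of_nonneg (Finset.subset_univ _)
    fun k _ _ => gravRow_nonneg hG hm q k

theorem gravSum_pos (hN : 2 ≤ N) (hG : 0 < G) (hm : ∀ i, 0 ≤ m i) (hm' : ∃ i, 0 < m i)
    (hq : q ∉ collisionSet N) : 0 < gravSum G m q := by
  obtain ⟨k, hk⟩ := hm'
  have : Nontrivial (Fin N) := Fin.nontrivial_iff_two_le.2 hN
  obtain ⟨i, hi⟩ := exists_ne k
  refine lt_of_lt_of_le ?_ (gravRow_le_gravSum hG hm q i)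
  refine lt_of_lt_of_le (div_pos (mul_pos hG hk) (pow_pos (norm_sub_pos_of_notMem hq hi) 2))
    (Finset.single_le_sum (f := fun j => G * m j / ‖q i - q j‖ ^ 2)
      (fun j _ => div_nonneg (mul_nonneg hG.le (hm j)) (by positivity)) ?_)
  simp [hi.symm]

theorem one_div_le_invDistSum {i j : Fin N} (h : i ≠ j) (q : Config N) :
    1 / ‖q i - q j‖ ≤ invDistSum q := by
  have h0 : ∀ i j, 0 ≤ 1 / ‖q i - q j‖ := fun i j => by positivity
  rcases lt_or_gt_of_ne h with h | h
  · exact le_sum_Ioi h0 h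
  · rw [norm_sub_rev]; exact le_sum_Ioi h0 h

theorem invDistSum_pos (hN : 2 ≤ N) (hq : q ∉ collisionSet N) : 0 < invDistSum q := by
  have : Nontrivial (Fin N) := Fin.nontrivial_iff_two_le.2 hN
  obtain ⟨i, j, hij⟩ := exists_pair_ne (Fin N)
  exact lt_of_lt_of_le (one_div_pos.2 (norm_sub_pos_of_notMem hq hij))
    (one_div_le_invDistSum hij q)

theorem invSqS_eq (G : ℝ) (m : Fin N → ℝ) (q v : Config N) : invSqS G m q v =
    (∑ i, ∑ j ∈ Finset.Ioi i, (‖v i - v j‖ / ‖q i - q j‖) ^ 2) +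
      invDistSum q * gravSum G m q := rfl

theorem invDistSum_mul_gravSum_le (G : ℝ) (m : Fin N → ℝ) (q v : Config N) :
    invDistSum q * gravSum G m q ≤ invSqS G m q v := by
  rw [invSqS_eq]
  exact le_add_of_nonneg_left
    (Finset.sum_nonneg fun _ _ => Finset.sum_nonneg fun _ _ => sq_nonneg _)

theorem invSqS_pos (hN : 2 ≤ N) (hG : 0 < G) (hm : ∀ i, 0 ≤ m i) (hm' : ∃ i, 0 < m i)
    (hq : q ∉ collisionSet N) (v : Config N) : 0 < invSqS G m q v :=
  lt_of_lt_of_le (mul_pos (invDistSum_pos hN hq) (gravSum_pos hN hG hm hm' hq))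
    (invDistSum_mul_gravSum_le G m q v)

/-- The squared ratio is one of the nonnegative terms of `s⁻²`. In fictitious time this bounds the
relative rate of change of every distance by 1. -/
theorem norm_velocity_sub_le (hN : 2 ≤ N) (hG : 0 < G) (hm : ∀ i, 0 ≤ m i)
    (hm' : ∃ i, 0 < m i) (hq : q ∉ collisionSet N) (v : Config N) (i j : Fin N) :
    ‖v i - v j‖ ≤ √(invSqS G m q v) * ‖q i - q j‖ := by
  rcases eq_or_ne i j with rfl | hij
  · simp
  have hle : (‖v i - v j‖ / ‖q i - q j‖) ^ 2 ≤ invSqS G m q v := by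
    have h1 : (‖v i - v j‖ / ‖q i - q j‖) ^ 2 ≤
        ∑ i, ∑ j ∈ Finset.Ioi i, (‖v i - v j‖ / ‖q i - q j‖) ^ 2 := by
      rcases lt_or_gt_of_ne hij with h | h
      · exact le_sum_Ioi (f := fun i j => (‖v i - v j‖ / ‖q i - q j‖) ^ 2)
          (fun _ _ => sq_nonneg _) h
      · rw [norm_sub_rev (v i), norm_sub_rev (q i)]
        exact le_sum_Ioi (f := fun i j => (‖v i - v j‖ / ‖q i - q j‖) ^ 2)
          (fun _ _ => sq_nonneg _) h
    rw [invSqS_eq]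
    have := (mul_pos (invDistSum_pos hN hq) (gravSum_pos hN hG hm hm' hq)).le
    linarith
  rw [← div_le_iff₀ (norm_sub_pos_of_notMem hq hij)]
  exact Real.le_sqrt_of_sq_le hle

theorem one_le_norm_sub_mul (hq : q ∉ collisionSet N) {i j : Fin N} (h : i ≠ j) :
    1 ≤ invDistSum q * ‖q i - q j‖ :=
  (div_le_iff₀ (norm_sub_pos_of_notMem hq h)).1 (one_div_le_invDistSum h q)

end Fixed

end Estimates

/-! ### The invariant box: bounds for the complex field near a real phase point. -/

section Box

variable {N : ℕ} {G : ℝ} {m : Fin N → ℝ}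

/-- The relative positions of `q` are close to those of the real configuration `q0`. -/
def NearPositions (q0 : Config N) (q : CConfig N) : Prop :=
  ∀ i j, ‖q i - q j - complexifyVec (q0 i - q0 j)‖ ≤ 0.085 * ‖q0 i - q0 j‖

/-- The differences `v i - v j` are close to those of the real velocities `v0`. -/
def NearVelocities (r : ℝ) (v0 : Config N) (v : CConfig N) : Prop :=
  ∀ i j, ‖v i - v j - complexifyVec (v0 i - v0 j)‖ ≤ r

theorem NearPositions.invSqrt_estimates {q0 : Config N} {q : CConfig N} (h : NearPositions q0 q)
    (hq0 : q0 ∉ collisionSet N) {i j : Fin N} (hij : i ≠ j) :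
    0 < (bil (q i - q j) (q i - q j)).re ∧
      ‖(bil (q i - q j) (q i - q j))⁻¹‖ ≤ 1.2154 / ‖q0 i - q0 j‖ ^ 2 ∧
      ‖(bil (q i - q j) (q i - q j))⁻¹ - ((1 / ‖q0 i - q0 j‖ ^ 2 : ℝ) : ℂ)‖ ≤
        0.2154 / ‖q0 i - q0 j‖ ^ 2 ∧
      ‖invSqrt (bil (q i - q j) (q i - q j))‖ ≤ 1.1026 / ‖q0 i - q0 j‖ ∧
      ‖invSqrt (bil (q i - q j) (q i - q j)) - ((1 / ‖q0 i - q0 j‖ : ℝ) : ℂ)‖ ≤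
        0.1025 / ‖q0 i - q0 j‖ :=
  NBody.invSqrt_estimates (norm_sub_pos_of_notMem hq0 hij)
    (norm_bil_self_sub_le_of_near (h i j))

/-- The distance allowed to the velocities. -/
def velocityRadius (G : ℝ) (m : Fin N → ℝ) (q0 v0 : Config N) : ℝ :=
  0.11 * √(invSqS G m q0 v0) / invDistSum q0

/-- A factor `1/A` of the velocity radius is kept in the first error term: the `1/‖q0 i - q0 j‖`
beside it sum to `A` over the pairs, so the total does not depend on `N`. -/
theorem norm_kinetic_term_sub_le (hN : 2 ≤ N) (hG : 0 < G) (hm : ∀ i, 0 ≤ m i)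
    (hm' : ∃ i, 0 < m i) {q0 v0 : Config N} (hq0 : q0 ∉ collisionSet N) {q v : CConfig N}
    (hq : NearPositions q0 q) (hv : NearVelocities (velocityRadius G m q0 v0) v0 v)
    {i j : Fin N} (hij : i ≠ j) :
    ‖bil (v i - v j) (v i - v j) * (bil (q i - q j) (q i - q j))⁻¹ -
        (((‖v0 i - v0 j‖ / ‖q0 i - q0 j‖) ^ 2 : ℝ) : ℂ)‖ ≤
      0.2821 * invSqS G m q0 v0 / invDistSum q0 * (1 / ‖q0 i - q0 j‖) +
        0.2154 * (‖v0 i - v0 j‖ / ‖q0 i - q0 j‖) ^ 2 := by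
  obtain ⟨-, h1, h2, -, -⟩ := hq.invSqrt_estimates hq0 hij
  have ha := norm_sub_pos_of_notMem hq0 hij
  have hb := norm_velocity_sub_le hN hG hm hm' hq0 v0 i j
  have hAa := one_le_norm_sub_mul hq0 hij
  have hA := invDistSum_pos hN hq0
  have hd := Real.sqrt_pos.2 (invSqS_pos hN hG hm hm' hq0 v0)
  have hd2 : invSqS G m q0 v0 = √(invSqS G m q0 v0) ^ 2 :=
    (Real.sq_sqrt (invSqS_pos hN hG hm hm' hq0 v0).le).symm
  have he := hv i j
  have hbil := norm_bil_self_sub_le (v i - v j) (complexifyVec (v0 i - v0 j))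
  rw [bil_complexifyVec, norm_complexifyVec] at hbil
  rw [velocityRadius] at he
  rw [hd2]
  set d := √(invSqS G m q0 v0)
  set A := invDistSum q0
  set a := ‖q0 i - q0 j‖
  set b := ‖v0 i - v0 j‖
  set e := ‖v i - v j - complexifyVec (v0 i - v0 j)‖
  set w := bil (q i - q j) (q i - q j)
  set z := bil (v i - v j) (v i - v j)
  have he0 : 0 ≤ e := norm_nonneg _
  have hb0 : 0 ≤ b := norm_nonneg _
  have hz : ‖z - ((b ^ 2 : ℝ) : ℂ)‖ ≤ 0.2321 * d ^ 2 / A * a := by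
    refine hbil.trans ?_
    have hp : 1 / A ≤ a := by rw [div_le_iff₀ hA]; linarith
    have h3 : 2 * b * e ≤ 2 * (d * a) * (0.11 * d / A) := by gcongr
    -- In only one of the two factors `e` is `1/A` replaced by the larger `a`; then `2 · 0.11 +
    -- 0.11² = 0.2321`.
    have h4 : e ^ 2 ≤ (0.11 * d / A) * (0.11 * d * a) := by
      rw [pow_two]
      refine mul_le_mul he (he.trans ?_) he0 (by positivity)
      calc 0.11 * d / A = 0.11 * d * (1 / A) := by ring
        _ ≤ 0.11 * d * a := by gcongr
    calc 2 * b * e + e ^ 2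
        ≤ 2 * (d * a) * (0.11 * d / A) + (0.11 * d / A) * (0.11 * d * a) := add_le_add h3 h4
      _ = 0.2321 * d ^ 2 / A * a := by ring
  have hsplit : z * w⁻¹ - (((b / a) ^ 2 : ℝ) : ℂ) =
      (z - ((b ^ 2 : ℝ) : ℂ)) * w⁻¹ + ((b ^ 2 : ℝ) : ℂ) * (w⁻¹ - ((1 / a ^ 2 : ℝ) : ℂ)) := by
    push_cast; ring
  rw [hsplit]
  refine (norm_add_le _ _).trans (add_le_add ?_ ?_)
  · rw [norm_mul]
    calc ‖z - ((b ^ 2 : ℝ) : ℂ)‖ * ‖w⁻¹‖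
        ≤ (0.2321 * d ^ 2 / A * a) * (1.2154 / a ^ 2) := by gcongr
      _ = (0.2321 * 1.2154) * d ^ 2 / A * (1 / a) := by field_simp
      _ ≤ 0.2821 * d ^ 2 / A * (1 / a) := by gcongr; norm_num
  · rw [norm_mul, Complex.norm_real, Real.norm_of_nonneg (by positivity)]
    calc b ^ 2 * ‖w⁻¹ - ((1 / a ^ 2 : ℝ) : ℂ)‖ ≤ b ^ 2 * (0.2154 / a ^ 2) := by gcongr
      _ = 0.2154 * (b / a) ^ 2 := by rw [div_pow]; ring

/-- The kinetic part contributes `0.2821 D + 0.2154 X`. The product `A K` has relative error at most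
`1.1025 · 1.2154 - 1 < 0.34`, and `0.2821 + 0.34 = 0.6221`. A total below 1 keeps the real part of
the complexified `s⁻²` positive. -/
theorem norm_cInvSqS_sub_le (hN : 2 ≤ N) (hG : 0 < G) (hm : ∀ i, 0 ≤ m i)
    (hm' : ∃ i, 0 < m i) {q0 v0 : Config N} (hq0 : q0 ∉ collisionSet N) {q v : CConfig N}
    (hq : NearPositions q0 q) (hv : NearVelocities (velocityRadius G m q0 v0) v0 v) :
    ‖cInvSqS G m q v - (invSqS G m q0 v0 : ℂ)‖ ≤ 0.6221 * invSqS G m q0 v0 := by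
  have hA := invDistSum_pos hN hq0
  have hK := gravSum_pos hN hG hm hm' hq0
  set X : ℝ := ∑ i, ∑ j ∈ Finset.Ioi i, (‖v0 i - v0 j‖ / ‖q0 i - q0 j‖) ^ 2 with hX
  have hX0 : 0 ≤ X := Finset.sum_nonneg fun _ _ => Finset.sum_nonneg fun _ _ => sq_nonneg _
  have hD : invSqS G m q0 v0 = X + invDistSum q0 * gravSum G m q0 := rfl
  set Z : ℂ := ∑ i, ∑ j ∈ Finset.Ioi i,
    bil (v i - v j) (v i - v j) * (bil (q i - q j) (q i - q j))⁻¹ with hZ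
  set L : ℂ := ∑ i, ∑ j ∈ Finset.Ioi i,
    ((G * (m i + m j) : ℝ) : ℂ) * (bil (q i - q j) (q i - q j))⁻¹ with hL
  have h1 : ‖Z - (X : ℂ)‖ ≤ 0.2821 * invSqS G m q0 v0 + 0.2154 * X := by
    have h := norm_sum_Ioi_sub_le (fun i j (hij : i < j) =>
      norm_kinetic_term_sub_le hN hG hm hm' hq0 hq hv hij.ne)
    simp only [Finset.sum_add_distrib, ← Finset.mul_sum] at h
    have h' : 0.2821 * invSqS G m q0 v0 / invDistSum q0 *
        (∑ i, ∑ j ∈ Finset.Ioi i, 1 / ‖q0 i - q0 j‖) = 0.2821 * invSqS G m q0 v0 := by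
      rw [← invDistSum]; field_simp
    rw [h'] at h
    rw [hZ, hX]
    push_cast at h ⊢
    exact h
  have h2 : ‖cInvDistSum q - (invDistSum q0 : ℂ)‖ ≤ 0.1025 * invDistSum q0 := by
    have h := norm_sum_Ioi_sub_le (fun i j (hij : i < j) =>
      (hq.invSqrt_estimates hq0 hij.ne).2.2.2.2)
    have h' : ∑ i, ∑ j ∈ Finset.Ioi i, 0.1025 / ‖q0 i - q0 j‖ = 0.1025 * invDistSum q0 := by
      simp only [invDistSum, Finset.mul_sum]
      refine Finset.sum_congr rfl fun i _ => Finset.sum_congr rfl fun j _ => by ring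
    rw [h'] at h
    rw [cInvDistSum, invDistSum]
    rw [invDistSum] at h
    push_cast at h ⊢
    exact h
  have h3 : ‖L - (gravSum G m q0 : ℂ)‖ ≤ 0.2154 * gravSum G m q0 := by
    have h := norm_sum_Ioi_sub_le (N := N)
      (f := fun i j => ((G * (m i + m j) : ℝ) : ℂ) * (bil (q i - q j) (q i - q j))⁻¹)
      (g := fun i j => ((G * (m i + m j) / ‖q0 i - q0 j‖ ^ 2 : ℝ) : ℂ))
      (h := fun i j => 0.2154 * (G * (m i + m j) / ‖q0 i - q0 j‖ ^ 2)) (fun i j hij => by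
        have hM : 0 ≤ G * (m i + m j) := mul_nonneg hG.le (add_nonneg (hm i) (hm j))
        have h' := (hq.invSqrt_estimates hq0 hij.ne).2.2.1
        rw [div_eq_mul_one_div, Complex.ofReal_mul _ (1 / _), ← mul_sub, norm_mul,
          Complex.norm_real, Real.norm_of_nonneg hM]
        refine (mul_le_mul_of_nonneg_left h' hM).trans (le_of_eq ?_)
        ring)
    simp only [← Finset.mul_sum] at h
    rw [hL, gravSum]
    push_cast at h ⊢
    exact h
  have hS : cInvSqS G m q v = Z + cInvDistSum q * L := rfl
  rw [hS, hD]
  set A := invDistSum q0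
  set K := gravSum G m q0
  have hsplit : Z + cInvDistSum q * L - ((X + A * K : ℝ) : ℂ) =
      (Z - X) + ((cInvDistSum q - A) * (L - K) + (cInvDistSum q - A) * K + A * (L - K)) := by
    push_cast; ring
  rw [hsplit]
  have h4 : ‖(cInvDistSum q - A) * (L - K)‖ ≤ (0.1025 * A) * (0.2154 * K) := by
    rw [norm_mul]; gcongr
  have h5 : ‖(cInvDistSum q - A) * (K : ℂ)‖ ≤ (0.1025 * A) * K := by
    rw [norm_mul, Complex.norm_real, Real.norm_of_nonneg hK.le]; gcongr
  have h6 : ‖(A : ℂ) * (L - K)‖ ≤ A * (0.2154 * K) := by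
    rw [norm_mul, Complex.norm_real, Real.norm_of_nonneg hA.le]; gcongr
  have h7 := norm_add_le (Z - X) ((cInvDistSum q - A) * (L - K) + (cInvDistSum q - A) * K +
    A * (L - K))
  have h8 := norm_add₃_le (a := (cInvDistSum q - A) * (L - K)) (b := (cInvDistSum q - A) * K)
    (c := A * (L - K))
  rw [hD] at h1
  have hAK : 0 < A * K := mul_pos hA hK
  nlinarith

theorem cInvSqS_re_pos_and_norm_le (hN : 2 ≤ N) (hG : 0 < G) (hm : ∀ i, 0 ≤ m i)
    (hm' : ∃ i, 0 < m i) {q0 v0 : Config N} (hq0 : q0 ∉ collisionSet N) {q v : CConfig N}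
    (hq : NearPositions q0 q) (hv : NearVelocities (velocityRadius G m q0 v0) v0 v) :
    0 < (cInvSqS G m q v).re ∧
      ‖invSqrt (cInvSqS G m q v)‖ ≤ 1.627 / √(invSqS G m q0 v0) := by
  have h := norm_cInvSqS_sub_le hN hG hm hm' hq0 hq hv
  have hD := invSqS_pos hN hG hm hm' hq0 v0
  set D := invSqS G m q0 v0
  set w := cInvSqS G m q v
  have hre : 0.3779 * D ≤ w.re := by
    have h1 := (abs_le.1 ((Complex.abs_re_le_norm _).trans h)).1
    rw [Complex.sub_re, Complex.ofReal_re] at h1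
    linarith
  have hre0 : 0 < w.re := lt_of_lt_of_le (by positivity) hre
  refine ⟨hre0, ?_⟩
  have hw0 : w ≠ 0 := by rintro h; rw [h] at hre0; simp at hre0
  have h1 : ‖invSqrt w‖ ^ 2 = ‖w‖⁻¹ := by rw [← norm_pow, invSqrt_sq hw0, norm_inv]
  have h2 : ‖w‖⁻¹ ≤ (0.3779 * D)⁻¹ :=
    inv_anti₀ (by positivity) (hre.trans (Complex.re_le_norm w))
  -- The constants satisfy `0.3779 = 1 - 0.6221` and `1.627² · 0.3779 > 1`.
  refine (sq_le_sq₀ (norm_nonneg _) (by positivity)).1 ?_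
  rw [h1, div_pow, Real.sq_sqrt hD.le]
  refine h2.trans ?_
  rw [inv_eq_one_div, div_le_div_iff₀ (by positivity) hD]
  nlinarith

/-- The constant bounds `1.1026 · 1.2154 · 1.085`, from the inverse distance, its square and the
displacement. -/
theorem norm_cAccel_le (hG : 0 < G) (hm : ∀ i, 0 ≤ m i) {q0 : Config N}
    (hq0 : q0 ∉ collisionSet N) {q : CConfig N} (hq : NearPositions q0 q) (i : Fin N) :
    ‖cAccel G m q i‖ ≤ 1.4541 * gravRow G m q0 i := by
  rw [cAccel, gravRow, Finset.mul_sum]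
  refine (norm_sum_le _ _).trans (Finset.sum_le_sum fun j hj => ?_)
  have hij := (Finset.ne_of_mem_erase hj).symm
  obtain ⟨-, h1, -, h2, -⟩ := hq.invSqrt_estimates hq0 hij
  have ha := norm_sub_pos_of_notMem hq0 hij
  have hM : 0 ≤ G * m j := mul_nonneg hG.le (hm j)
  have h3 : ‖q j - q i‖ ≤ 1.085 * ‖q0 i - q0 j‖ := by
    have h4 := hq i j
    have h5 := norm_add_le (q i - q j - complexifyVec (q0 i - q0 j)) (complexifyVec (q0 i - q0 j))
    rw [sub_add_cancel, norm_complexifyVec] at h5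
    rw [norm_sub_rev]
    linarith
  rw [norm_smul, norm_mul, norm_mul, Complex.norm_real, Real.norm_of_nonneg hM]
  set a := ‖q0 i - q0 j‖
  calc _ ≤ G * m j * (1.1026 / a * (1.2154 / a ^ 2)) * (1.085 * a) := by gcongr
    _ = (1.1026 * 1.2154 * 1.085) * (G * m j / a ^ 2) := by field_simp
    _ ≤ 1.4541 * (G * m j / a ^ 2) := by gcongr; norm_num

/-- The compact convex set in which the complex solutions starting at `(q0, v0)` stay. -/
def box (G : ℝ) (m : Fin N → ℝ) (q0 v0 : Config N) : Set (CConfig N × CConfig N) :=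
  {x | ‖x.1 - complexify q0‖ ≤ ‖v0‖ / √(invSqS G m q0 v0) + 1 / invDistSum q0 ∧
    ‖x.2 - complexify v0‖ ≤ velocityRadius G m q0 v0 ∧
    NearPositions q0 x.1 ∧ NearVelocities (velocityRadius G m q0 v0) v0 x.2}

theorem convex_setOf_norm_sub_le {E F : Type*} [NormedAddCommGroup E] [NormedSpace ℝ E]
    [NormedAddCommGroup F] [NormedSpace ℝ F] {f : E → F} (hf : IsLinearMap ℝ f) (c : F) (r : ℝ) :
    Convex ℝ {x | ‖f x - c‖ ≤ r} := by
  have h : {x | ‖f x - c‖ ≤ r} = f ⁻¹' closedBall c r := by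
    ext x; simp [dist_eq_norm]
  rw [h]
  exact (convex_closedBall c r).is_linear_preimage hf

theorem convex_box (G : ℝ) (m : Fin N → ℝ) (q0 v0 : Config N) : Convex ℝ (box G m q0 v0) := by
  have h : box G m q0 v0 =
      {x | ‖x.1 - complexify q0‖ ≤ ‖v0‖ / √(invSqS G m q0 v0) + 1 / invDistSum q0} ∩
      ({x | ‖x.2 - complexify v0‖ ≤ velocityRadius G m q0 v0} ∩
      ((⋂ i, ⋂ j, {x | ‖x.1 i - x.1 j - complexifyVec (q0 i - q0 j)‖ ≤ 0.085 * ‖q0 i - q0 j‖}) ∩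
      (⋂ i, ⋂ j, {x | ‖x.2 i - x.2 j - complexifyVec (v0 i - v0 j)‖ ≤
        velocityRadius G m q0 v0}))) := by
    ext x
    simp only [box, NearPositions, NearVelocities, mem_ofPred_eq, mem_inter_iff, mem_iInter]
  rw [h]
  refine (convex_setOf_norm_sub_le ⟨fun _ _ => rfl, fun _ _ => rfl⟩ _ _).inter
    ((convex_setOf_norm_sub_le ⟨fun _ _ => rfl, fun _ _ => rfl⟩ _ _).inter
    ((convex_iInter fun i => convex_iInter fun j => ?_).inter
      (convex_iInter fun i => convex_iInter fun j => ?_)))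
  · exact convex_setOf_norm_sub_le (f := fun x : CConfig N × CConfig N => x.1 i - x.1 j)
      ⟨fun x y => by simp only [Prod.fst_add, Pi.add_apply]; abel,
        fun c x => by simp only [Prod.smul_fst, Pi.smul_apply, smul_sub]⟩ _ _
  · exact convex_setOf_norm_sub_le (f := fun x : CConfig N × CConfig N => x.2 i - x.2 j)
      ⟨fun x y => by simp only [Prod.snd_add, Pi.add_apply]; abel,
        fun c x => by simp only [Prod.smul_snd, Pi.smul_apply, smul_sub]⟩ _ _

theorem isCompact_box (G : ℝ) (m : Fin N → ℝ) (q0 v0 : Config N) :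
    IsCompact (box G m q0 v0) := by
  refine IsCompact.of_isClosed_subset
    ((isCompact_closedBall (complexify q0) (‖v0‖ / √(invSqS G m q0 v0) + 1 / invDistSum q0)).prod
      (isCompact_closedBall (complexify v0) (velocityRadius G m q0 v0))) ?_ ?_
  · simp only [box, NearPositions, NearVelocities, ofPred_and, ofPred_forall]
    refine (isClosed_le (by fun_prop) continuous_const).inter
      ((isClosed_le (by fun_prop) continuous_const).inter
      ((isClosed_iInter fun i => isClosed_iInter fun j => isClosed_le ?_ continuous_const).inter
      (isClosed_iInter fun i => isClosed_iInter fun j => isClosed_le ?_ continuous_const))) <;>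
      fun_prop
  · rintro x ⟨h1, h2, -⟩
    exact ⟨mem_closedBall_iff_norm.2 h1, mem_closedBall_iff_norm.2 h2⟩

theorem norm_complexify (x : Config N) : ‖complexify x‖ = ‖x‖ := by
  refine le_antisymm ((pi_norm_le_iff_of_nonneg (norm_nonneg _)).2 fun i => ?_)
    ((pi_norm_le_iff_of_nonneg (norm_nonneg _)).2 fun i => ?_)
  · rw [complexify_apply, norm_complexifyVec]; exact norm_le_pi_norm x i
  · rw [← norm_complexifyVec, ← complexify_apply]; exact norm_le_pi_norm (complexify x) i

theorem complexifyPhase_mem_box (hN : 2 ≤ N) {q0 : Config N} (hq0 : q0 ∉ collisionSet N)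
    (v0 : Config N) : complexifyPhase (q0, v0) ∈ box G m q0 v0 := by
  have hA := invDistSum_pos hN hq0
  have hr : 0 ≤ velocityRadius G m q0 v0 := by unfold velocityRadius; positivity
  refine ⟨?_, ?_, fun i j => ?_, fun i j => ?_⟩
  · simp only [complexifyPhase, sub_self, norm_zero]; positivity
  · simpa [complexifyPhase] using hr
  · simp only [complexifyPhase, complexify_apply, complexifyVec_sub, sub_self, norm_zero]
    positivity
  · simpa [complexifyPhase, complexify_apply, complexifyVec_sub] using hr

/-- The radii 0.085, 0.11 and 0.046 are matched here. With `0.046 · 1.627 < 0.07485`, velocities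
move by at most `0.07485 · 1.4541 < 0.11` times `√D/A`, and relative positions by at most `0.07485 ·
1.11 < 0.085` times their size. The bounds on absolute position and velocity in the box serve only
its compactness. -/
theorem box_step (hN : 2 ≤ N) (hG : 0 < G) (hm : ∀ i, 0 ≤ m i) (hm' : ∃ i, 0 < m i)
    {q0 v0 : Config N} (hq0 : q0 ∉ collisionSet N) {x : CConfig N × CConfig N}
    (hx : x ∈ box G m q0 v0) {τ : ℂ} (hτ : ‖τ‖ < 0.046) :
    complexifyPhase (q0, v0) + τ • cField G m x ∈ box G m q0 v0 := by
  obtain ⟨-, hx2, hx3, hx4⟩ := hx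
  obtain ⟨-, hs⟩ := cInvSqS_re_pos_and_norm_le hN hG hm hm' hq0 hx3 hx4
  have hA := invDistSum_pos hN hq0
  have hd := Real.sqrt_pos.2 (invSqS_pos hN hG hm hm' hq0 v0)
  have hAK := invDistSum_mul_gravSum_le G m q0 v0
  rw [← Real.sq_sqrt (invSqS_pos hN hG hm hm' hq0 v0).le] at hAK
  set c := τ * invSqrt (cInvSqS G m x.1 x.2) with hc
  have hfield : τ • cField G m x = (c • x.2, c • cAccel G m x.1) := by
    rw [cField, smul_smul, Prod.smul_mk]
  have hcn : ‖c‖ ≤ 0.07485 / √(invSqS G m q0 v0) := by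
    rw [hc, norm_mul]
    calc _ ≤ 0.046 * (1.627 / √(invSqS G m q0 v0)) := by gcongr
      _ = (0.046 * 1.627) / √(invSqS G m q0 v0) := by ring
      _ ≤ _ := by gcongr; norm_num
  have hacc : ∀ g : C3, ‖g‖ ≤ 1.4541 * gravSum G m q0 →
      ‖c • g‖ ≤ velocityRadius G m q0 v0 := by
    intro g hg
    rw [norm_smul, velocityRadius]
    have hK : 0 ≤ gravSum G m q0 := (gravSum_pos hN hG hm hm' hq0).le
    calc ‖c‖ * ‖g‖ ≤ 0.07485 / √(invSqS G m q0 v0) * (1.4541 * gravSum G m q0) := by gcongr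
      _ = (0.07485 * 1.4541) * (gravSum G m q0 / √(invSqS G m q0 v0)) := by ring
      _ ≤ 0.11 * (√(invSqS G m q0 v0) / invDistSum q0) := by
        gcongr ?_ * ?_
        · norm_num
        -- This is `A K ≤ D`, in the form `K/√D ≤ √D/A`.
        · rw [div_le_div_iff₀ hd hA]; nlinarith
      _ = _ := by ring
  have hr : 0 ≤ velocityRadius G m q0 v0 := by unfold velocityRadius; positivity
  -- The space is arbitrary because the bound is applied to the whole velocity configuration and to
  -- single differences.
  have hpos : ∀ {E : Type} [NormedAddCommGroup E] [NormedSpace ℂ E] (u : E) (r : ℝ),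
      ‖u‖ ≤ r + velocityRadius G m q0 v0 →
      ‖c • u‖ ≤ 0.07485 * (r / √(invSqS G m q0 v0) + 0.11 / invDistSum q0) := by
    intro E _ _ u r hu
    rw [norm_smul]
    calc ‖c‖ * ‖u‖ ≤ 0.07485 / √(invSqS G m q0 v0) * (r + velocityRadius G m q0 v0) := by gcongr
      _ = _ := by rw [velocityRadius]; field_simp
  rw [hfield]
  refine ⟨?_, ?_, fun i j => ?_, fun i j => ?_⟩
  · simp only [complexifyPhase, Prod.fst_add, add_sub_cancel_left]
    have h1 : ‖x.2‖ ≤ ‖v0‖ + velocityRadius G m q0 v0 := by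
      have := norm_add_le (complexify v0) (x.2 - complexify v0)
      rw [add_sub_cancel, norm_complexify] at this
      linarith
    refine (hpos _ _ h1).trans ?_
    have h2 : 0 ≤ ‖v0‖ / √(invSqS G m q0 v0) := by positivity
    have h3 : 0 < 1 / invDistSum q0 := by positivity
    have h4 : 0.11 / invDistSum q0 = 0.11 * (1 / invDistSum q0) := by ring
    rw [h4]
    linarith
  · simp only [complexifyPhase, Prod.snd_add, add_sub_cancel_left]
    refine (pi_norm_le_iff_of_nonneg hr).2 fun i => hacc _ ?_
    refine (norm_cAccel_le hG hm hq0 hx3 i).trans ?_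
    gcongr
    exact gravRow_le_gravSum hG hm q0 i
  · have h1 : (complexifyPhase (q0, v0) + (c • x.2, c • cAccel G m x.1)).1 i -
        (complexifyPhase (q0, v0) + (c • x.2, c • cAccel G m x.1)).1 j -
        complexifyVec (q0 i - q0 j) = c • (x.2 i - x.2 j) := by
      simp only [complexifyPhase, Prod.fst_add, Pi.add_apply, Pi.smul_apply, complexify_apply,
        complexifyVec_sub, smul_sub]
      abel
    rw [h1]
    rcases eq_or_ne i j with rfl | hij
    · simp
    have ha := norm_sub_pos_of_notMem hq0 hij
    have h2 : ‖x.2 i - x.2 j‖ ≤ ‖v0 i - v0 j‖ + velocityRadius G m q0 v0 := by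
      have := norm_add_le (complexifyVec (v0 i - v0 j))
        (x.2 i - x.2 j - complexifyVec (v0 i - v0 j))
      rw [add_sub_cancel, norm_complexifyVec] at this
      linarith [hx4 i j]
    refine (hpos _ _ h2).trans ?_
    have h3 : ‖v0 i - v0 j‖ / √(invSqS G m q0 v0) ≤ ‖q0 i - q0 j‖ := by
      rw [div_le_iff₀ hd, mul_comm]
      exact norm_velocity_sub_le hN hG hm hm' hq0 v0 i j
    have h4 : 0.11 / invDistSum q0 ≤ 0.11 * ‖q0 i - q0 j‖ := by
      rw [div_le_iff₀ hA]
      nlinarith [one_le_norm_sub_mul hq0 hij]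
    linarith
  · have h1 : (complexifyPhase (q0, v0) + (c • x.2, c • cAccel G m x.1)).2 i -
        (complexifyPhase (q0, v0) + (c • x.2, c • cAccel G m x.1)).2 j -
        complexifyVec (v0 i - v0 j) = c • (cAccel G m x.1 i - cAccel G m x.1 j) := by
      simp only [complexifyPhase, Prod.snd_add, Pi.add_apply, Pi.smul_apply, complexify_apply,
        complexifyVec_sub, smul_sub]
      abel
    rw [h1]
    rcases eq_or_ne i j with rfl | hij
    · simpa using hr
    -- For distinct bodies the two rows add up to at most one `gravSum`, so a difference of
    -- accelerations obeys the same bound as a single one.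
    refine hacc _ ((norm_sub_le _ _).trans ?_)
    have h2 := norm_cAccel_le hG hm hq0 hx3 i
    have h3 := norm_cAccel_le hG hm hq0 hx3 j
    have h4 := gravRow_add_le_gravSum hG hm q0 hij
    linarith

end Box

/-! ### Global solutions of the renormalized equations and the two conclusions. -/

section Renormalized

variable {N : ℕ} {G : ℝ} {m : Fin N → ℝ}

/-- The real parts of a point of the complexified phase space. -/
def rePhase (N : ℕ) : (CConfig N × CConfig N) →L[ℝ] (Config N × Config N) where
  toFun x := (fun i => WithLp.toLp 2 fun k => (x.1 i k).re,
    fun i => WithLp.toLp 2 fun k => (x.2 i k).re)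
  map_add' x y := by ext <;> simp
  map_smul' c x := by ext <;> simp
  cont := by fun_prop

theorem rePhase_complexifyPhase (x : Config N × Config N) : rePhase N (complexifyPhase x) = x := by
  ext <;> rfl

theorem complexify_add (x y : Config N) : complexify (x + y) = complexify x + complexify y := by
  funext i
  ext k
  simp [complexify_apply]

theorem complexifyPhase_add (x y : Config N × Config N) :
    complexifyPhase (x + y) = complexifyPhase x + complexifyPhase y := by
  simp only [complexifyPhase, Prod.fst_add, Prod.snd_add, complexify_add, Prod.mk_add_mk]

theorem complexifyPhase_smul (c : ℝ) (x : Config N × Config N) :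
    complexifyPhase (c • x) = (c : ℂ) • complexifyPhase x := by
  simp only [complexifyPhase, Prod.smul_fst, Prod.smul_snd, complexify_smul, Prod.smul_mk]

theorem continuous_complexify : Continuous (complexify : Config N → CConfig N) := by
  unfold complexify; fun_prop

theorem isClosed_range_complexifyPhase :
    IsClosed (range (complexifyPhase : Config N × Config N → CConfig N × CConfig N)) := by
  have h : range (complexifyPhase : Config N × Config N → CConfig N × CConfig N) =
      {x | complexifyPhase (rePhase N x) = x} := by
    ext x
    constructor
    · rintro ⟨y, rfl⟩
      exact congrArg complexifyPhase (rePhase_complexifyPhase y)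
    · exact fun h => ⟨_, h⟩
  rw [h]
  refine isClosed_eq ?_ continuous_id
  exact ((continuous_complexify.comp continuous_fst).prodMk
    (continuous_complexify.comp continuous_snd)).comp (rePhase N).continuous

theorem convex_range_complexifyPhase :
    Convex ℝ (range (complexifyPhase : Config N × Config N → CConfig N × CConfig N)) := by
  rintro _ ⟨x, rfl⟩ _ ⟨y, rfl⟩ a b - - -
  refine ⟨a • x + b • y, ?_⟩
  rw [complexifyPhase_add, complexifyPhase_smul, complexifyPhase_smul, Complex.coe_smul,
    Complex.coe_smul]

/-- The renormalized field. -/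
def renField (G : ℝ) (m : Fin N → ℝ) (x : Config N × Config N) : Config N × Config N :=
  sAlt G m x.1 x.2 • physField G m x

/-- A collision `x_i = x_j` would give `‖q0 i - q0 j‖ ≤ 0.085 ‖q0 i - q0 j‖`. -/
theorem mem_regularSet_of_mem_box {q0 v0 : Config N} (hq0 : q0 ∉ collisionSet N)
    {x : Config N × Config N} (hx : complexifyPhase x ∈ box G m q0 v0) : x ∈ regularSet N := by
  rintro ⟨i, j, hij, he⟩
  have h := hx.2.2.1 i j
  simp only [complexifyPhase, complexify_apply, he, sub_self, zero_sub, norm_neg,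
    norm_complexifyVec] at h
  linarith [norm_sub_pos_of_notMem hq0 hij]

theorem exists_lipschitzOnWith_box (hN : 2 ≤ N) (hG : 0 < G) (hm : ∀ i, 0 ≤ m i)
    (hm' : ∃ i, 0 < m i) {q0 : Config N} (hq0 : q0 ∉ collisionSet N) (v0 : Config N) :
    (∀ x ∈ box G m q0 v0, ContDiffAt ℂ 1 (cField G m) x) ∧
      ∃ K, LipschitzOnWith K (cField G m) (box G m q0 v0) := by
  have hF : ∀ x ∈ box G m q0 v0, ContDiffAt ℂ 1 (cField G m) x := fun x hx =>
    contDiffAt_cField G m (fun i j hij => (hx.2.2.1.invSqrt_estimates hq0 hij).1)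
      (cInvSqS_re_pos_and_norm_le hN hG hm hm' hq0 hx.2.2.1 hx.2.2.2).1
  refine ⟨hF, LocallyLipschitzOn.exists_lipschitzOnWith_of_compact (isCompact_box G m q0 v0) ?_⟩
  intro x hx
  obtain ⟨K, t, ht, hK⟩ := (hF x hx).exists_lipschitzOnWith
  exact ⟨K, t, mem_nhdsWithin_of_mem_nhds ht, hK⟩

/-- From every regular phase point there starts a solution of the renormalized equations that is
holomorphic on the disc of radius `0.046`. -/
theorem exists_local_solution (hN : 2 ≤ N) (hG : 0 < G) (hm : ∀ i, 0 ≤ m i)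
    (hm' : ∃ i, 0 < m i) {x0 : Config N × Config N} (hx0 : x0 ∈ regularSet N) :
    ∃ (f : ℂ → CConfig N × CConfig N) (γ : ℝ → Config N × Config N),
      DifferentiableOn ℂ f (ball 0 0.046) ∧ γ 0 = x0 ∧
      IsTrajectory (renField G m) (regularSet N) (Ioo (-0.046) 0.046) γ ∧
      ∀ t : ℝ, |t| < 0.046 → f t = complexifyPhase (γ t) := by
  obtain ⟨q0, v0⟩ := x0
  have hq0 : q0 ∉ collisionSet N := hx0
  obtain ⟨hF, K, hK⟩ := exists_lipschitzOnWith_box hN hG hm hm' hq0 v0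
  have hreal : ∀ y, complexifyPhase y ∈ box G m q0 v0 →
      cField G m (complexifyPhase y) = complexifyPhase (renField G m y) := fun y hy =>
    cField_complexifyPhase G m y
      (invSqS_pos hN hG hm hm' (mem_regularSet_of_mem_box hq0 hy) y.2).le
  -- `W` is the real phase space inside its complexification, so that the solution is real at real
  -- times.
  obtain ⟨f, hf0, hf, hfr⟩ := exists_holomorphic_solution (ρ := 0.046) (convex_box G m q0 v0)
    (isCompact_box G m q0 v0) (fun x hx => (hF x hx).differentiableAt one_ne_zero) hK
    (complexifyPhase_mem_box hN hq0 v0)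
    (fun x hx τ hτ => box_step hN hG hm hm' hq0 hx hτ)
    convex_range_complexifyPhase isClosed_range_complexifyPhase ⟨_, rfl⟩
    (by
      rintro _ hx ⟨y, rfl⟩ t
      refine ⟨(q0, v0) + t • renField G m y, ?_⟩
      rw [complexifyPhase_add, complexifyPhase_smul, hreal y hx])
  have hball : ∀ t : ℝ, |t| < 0.046 → (t : ℂ) ∈ ball (0 : ℂ) 0.046 := fun t ht => by
    rwa [mem_ball_zero_iff, Complex.norm_real]
  have hγ : ∀ t : ℝ, |t| < 0.046 → f t = complexifyPhase (rePhase N (f t)) := by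
    intro t ht
    obtain ⟨y, hy⟩ := hfr t (hball t ht)
    rw [← hy, rePhase_complexifyPhase]
  refine ⟨f, fun t => rePhase N (f t), fun z hz =>
    (hf z hz).2.differentiableAt.differentiableWithinAt, ?_, fun t ht => ?_, hγ⟩
  · simp only [Complex.ofReal_zero, hf0, rePhase_complexifyPhase]
  · have ht' := abs_lt.2 ht
    obtain ⟨hB, hd⟩ := hf t (hball t ht')
    have hB' := hB
    rw [hγ t ht'] at hB'
    refine ⟨mem_regularSet_of_mem_box hq0 hB', ?_⟩
    have h1 : HasDerivAt (fun t : ℝ => f t) (cField G m (f t)) t := by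
      have h2 := hasDerivAt_ray (z := 1) (u := t) (by rwa [mul_one])
      simpa only [mul_one, one_smul] using h2
    have h2 := (rePhase N).hasFDerivAt.comp_hasDerivAt t h1
    have h3 : rePhase N (cField G m (f t)) = renField G m (rePhase N (f t)) := by
      rw [hγ t ht', hreal _ hB', rePhase_complexifyPhase, rePhase_complexifyPhase]
    rw [h3] at h2
    exact h2

theorem contDiffAt_renField (hN : 2 ≤ N) (hG : 0 < G) (hm : ∀ i, 0 ≤ m i)
    (hm' : ∃ i, 0 < m i) (x : Config N × Config N) (hx : x ∈ regularSet N) :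
    ContDiffAt ℝ 1 (renField G m) x :=
  (contDiffAt_sAlt G m hx (invSqS_pos hN hG hm hm' hx x.2)).smul (contDiffAt_physField G m hx)

/-- The solutions of the renormalized equations exist for all time and extend to a strip. -/
theorem exists_global_solution (hN : 2 ≤ N) (hG : 0 < G) (hm : ∀ i, 0 ≤ m i)
    (hm' : ∃ i, 0 < m i) {x0 : Config N × Config N} (hx0 : x0 ∈ regularSet N) :
    ∃ (Γ : ℝ → Config N × Config N) (F : ℂ → CConfig N × CConfig N), Γ 0 = x0 ∧
      IsTrajectory (renField G m) (regularSet N) univ Γ ∧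
      AnalyticOnNhd ℂ F {z | |z.im| < 0.046} ∧ ∀ t : ℝ, F t = complexifyPhase (Γ t) := by
  have hX := contDiffAt_renField hN hG hm hm'
  have hρ : (0 : ℝ) < 0.046 := by norm_num
  obtain ⟨Γ, hΓ0, hΓ⟩ := exists_isTrajectory_univ hX hρ (fun x hx => by
    obtain ⟨f, γ, -, h0, h1, -⟩ := exists_local_solution hN hG hm hm' hx
    exact ⟨γ, h0, h1⟩) hx0
  obtain ⟨F, hF, hF'⟩ := exists_analyticOnNhd_strip (g := fun t => complexifyPhase (Γ t)) hρ
    (fun τ => by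
      obtain ⟨f, γ, hf, h0, h1, h2⟩ := exists_local_solution hN hG hm hm' (hΓ τ trivial).1
      refine ⟨f, hf, fun t ht => ?_⟩
      -- By uniqueness the local solution started at `Γ τ` is the translate of `Γ` by `τ`, so its
      -- disc continues `Γ` around `τ`.
      have h3 := (hΓ.comp_sub_const (-τ)).mono (subset_univ (Ioo (-0.046 : ℝ) 0.046))
      have h4 := h1.eqOn hX isOpen_Ioo ordConnected_Ioo h3 (t0 := 0) (by norm_num)
        (by simp [h0]) (abs_lt.1 ht)
      rw [h2 t ht, h4]
      simp only [sub_neg_eq_add, add_comm])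
  exact ⟨Γ, F, hΓ0, hΓ, hF, hF'⟩

theorem isTrajectory_iff {f : Config N × Config N → Config N × Config N} {I : Set ℝ}
    {q v : ℝ → Config N} : IsTrajectory f (regularSet N) I (fun t => (q t, v t)) ↔
      ∀ t ∈ I, q t ∉ collisionSet N ∧ HasDerivAt q (f (q t, v t)).1 t ∧
        HasDerivAt v (f (q t, v t)).2 t := by
  refine forall₂_congr fun t _ => and_congr Iff.rfl ⟨fun h => ⟨?_, ?_⟩, fun h => ?_⟩
  · exact (ContinuousLinearMap.fst ℝ (Config N) (Config N)).hasFDerivAt.comp_hasDerivAt t h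
  · exact (ContinuousLinearMap.snd ℝ (Config N) (Config N)).hasFDerivAt.comp_hasDerivAt t h
  · exact h.1.prodMk h.2

theorem isPreconnected_strip (β : ℝ) : IsPreconnected (strip β) := by
  have h : strip β = Complex.im ⁻¹' Icc (-β) β := by
    ext z; exact abs_le (a := z.im)
  rw [h]
  exact ((convex_Icc (-β) β).linear_preimage Complex.imLm).isPreconnected

theorem isUniformGlobalTimeRenormalization_sAlt (hN : 2 ≤ N) (hG : 0 < G) (hm : ∀ i, 0 ≤ m i)
    (hm' : ∃ i, 0 < m i) {β : ℝ} (hβ : 0 < β) (hβ' : β < 0.046) :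
    IsUniformGlobalTimeRenormalization G m (sAlt G m) β := by
  have hpos : ∀ q ∉ collisionSet N, ∀ v, 0 < sAlt G m q v := fun q hq v =>
    Real.rpow_pos_of_pos (invSqS_pos hN hG hm hm' hq v) _
  refine ⟨hβ, fun x hx => ?_, hpos, ?_⟩
  -- Real-analyticity is smoothness of order `ω`.
  · rw [← analyticWithinAt_univ, ← contDiffWithinAt_omega_iff_analyticWithinAt,
      contDiffWithinAt_univ]
    exact contDiffAt_sAlt G m hx.1 (invSqS_pos hN hG hm hm' hx.1 x.2)
  intro q0 hq0 v0 I q v hmax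
  obtain ⟨Γ, F, hΓ0, hΓ, hF, hF'⟩ := exists_global_solution hN hG hm hm' (x0 := (q0, v0)) hq0
  obtain ⟨hbij, hval⟩ := bijOn_fictitiousTime_of_global (f := physField G m)
    (s := fun x => sAlt G m x.1 x.2) (γ := fun t => (q t, v t))
    (fun x hx => contDiffAt_physField G m hx)
    (fun x hx => (contDiffAt_sAlt (n := 1) G m hx (invSqS_pos hN hG hm hm' hx x.2)).continuousAt)
    (fun x hx => hpos _ hx _) hΓ hmax.isOpen hmax.ordConnected hmax.zero_mem
    (isTrajectory_iff.2 hmax.solution) (by rw [hΓ0, hmax.init_q, hmax.init_v])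
    (fun J η hJ hJc hIJ hη he => hmax.maximal J (fun t => (η t).1) (fun t => (η t).2) hJ hJc hIJ
      (isTrajectory_iff.1 hη) (fun t ht => congrArg Prod.fst (he ht))
      (fun t ht => congrArg Prod.snd (he ht)))
  have hsub : strip β ⊆ {z | |z.im| < 0.046} := fun z hz => lt_of_le_of_lt hz hβ'
  refine ⟨hbij, fun z => (F z).1, fun z => (F z).2, fun z hz => ?_, fun z hz => ?_,
    fun t ht => ?_⟩
  · exact analyticAt_fst.comp (hF z (hsub hz))
  · exact analyticAt_snd.comp (hF z (hsub hz))
  · have h := hF' (fictitiousTime (sAlt G m) q v t)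
    have h' : Γ (fictitiousTime (sAlt G m) q v t) = (q t, v t) := hval t ht
    rw [h'] at h
    exact ⟨congrArg Prod.fst h, congrArg Prod.snd h⟩

theorem exists_isHolomorphicRenormalizedSolution (hN : 2 ≤ N) (hG : 0 < G) (hm : ∀ i, 0 ≤ m i)
    (hm' : ∃ i, 0 < m i) {β : ℝ} (hβ' : β < 0.046) {q0 : Config N}
    (hq0 : q0 ∉ collisionSet N) (v0 : Config N) :
    ∃ Q V : ℂ → CConfig N, IsHolomorphicRenormalizedSolution G m (sAlt G m) β q0 v0 Q V := by
  obtain ⟨Γ, F, hΓ0, hΓ, hF, hF'⟩ := exists_global_solution hN hG hm hm' (x0 := (q0, v0)) hq0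
  have hsub : strip β ⊆ {z | |z.im| < 0.046} := fun z hz => lt_of_le_of_lt hz hβ'
  refine ⟨fun z => (F z).1, fun z => (F z).2, fun z hz => analyticAt_fst.comp (hF z (hsub hz)),
    fun z hz => analyticAt_snd.comp (hF z (hsub hz)), fun t => (Γ t).1, fun t => (Γ t).2,
    congrArg Prod.fst hΓ0, congrArg Prod.snd hΓ0, fun τ => ?_, fun τ => ?_⟩
  · exact isTrajectory_iff (f := renField G m).1 hΓ τ trivial
  · exact ⟨congrArg Prod.fst (hF' τ), congrArg Prod.snd (hF' τ)⟩

/-- Uniqueness for the real equations determines the values on the real axis, and the identity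
theorem carries this over the connected strip. -/
theorem IsHolomorphicRenormalizedSolution.eqOn (hN : 2 ≤ N) (hG : 0 < G) (hm : ∀ i, 0 ≤ m i)
    (hm' : ∃ i, 0 < m i) {β : ℝ} (hβ : 0 ≤ β) {q0 v0 : Config N} {Q V Q' V' : ℂ → CConfig N}
    (h : IsHolomorphicRenormalizedSolution G m (sAlt G m) β q0 v0 Q V)
    (h' : IsHolomorphicRenormalizedSolution G m (sAlt G m) β q0 v0 Q' V') :
    EqOn Q' Q (strip β) ∧ EqOn V' V (strip β) := by
  obtain ⟨hQ, hV, q, v, hq, hv, hode, hval⟩ := h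
  obtain ⟨hQ', hV', q', v', hq', hv', hode', hval'⟩ := h'
  have h1 : EqOn (fun t => (q' t, v' t)) (fun t => (q t, v t)) univ :=
    IsTrajectory.eqOn (contDiffAt_renField hN hG hm hm') isOpen_univ ordConnected_univ
      (isTrajectory_iff.2 fun t _ => hode' t) (isTrajectory_iff.2 fun t _ => hode t)
      (mem_univ 0) (by simp [hq, hv, hq', hv'])
  have h0 : ((0 : ℝ) : ℂ) ∈ strip β := by simpa [strip] using hβ
  constructor
  · refine eqOn_of_eventually_real_eq (isPreconnected_strip β) hQ' hQ h0
      (Eventually.of_forall fun t => ?_)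
    rw [(hval t).1, (hval' t).1, show q' t = q t from congrArg Prod.fst (h1 (mem_univ t))]
  · refine eqOn_of_eventually_real_eq (isPreconnected_strip β) hV' hV h0
      (Eventually.of_forall fun t => ?_)
    rw [(hval t).2, (hval' t).2, show v' t = v t from congrArg Prod.snd (h1 (mem_univ t))]

end Renormalized

end NBody
end

theorem mainTheorem6 (N : ℕ) (hN : 2 ≤ N) (G : ℝ) (hG : 0 < G)
    (m : Fin N → ℝ) (hm : ∀ i, 0 ≤ m i) (hm' : ∃ i, 0 < m i) :
    NBody.IsUniformGlobalTimeRenormalization G m (NBody.sAlt G m) 0.0444443 ∧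
    ∀ q0 ∉ NBody.collisionSet N, ∀ v0 : NBody.Config N,
      ∃ Q V : ℂ → NBody.CConfig N,
        NBody.IsHolomorphicRenormalizedSolution G m (NBody.sAlt G m) 0.0444443 q0 v0 Q V ∧
        ∀ Q' V' : ℂ → NBody.CConfig N,
          NBody.IsHolomorphicRenormalizedSolution G m (NBody.sAlt G m) 0.0444443 q0 v0 Q' V' →
          Set.EqOn Q' Q (NBody.strip 0.0444443) ∧ Set.EqOn V' V (NBody.strip 0.0444443) := by
  refine ⟨NBody.isUniformGlobalTimeRenormalization_sAlt hN hG hm hm' (by norm_num) (by norm_num),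
    fun q0 hq0 v0 => ?_⟩
  obtain ⟨Q, V, h⟩ := NBody.exists_isHolomorphicRenormalizedSolution hN hG hm hm'
    (β := 0.0444443) (by norm_num) hq0 v0
  exact ⟨Q, V, h, fun Q' V' h' => h.eqOn hN hG hm hm' (by norm_num) h'⟩
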